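/- **Setting.** Consider a radial (tree) network with a slack bus and $n\ge 1$ further nodes $\mathcal N=\{1,\dots,n\}$, and $n$ lines with nonzero resistances $r_e$ and reactances $x_e$. Let $A\in\{-1,0,1\}^{n\times n}$ be its edge-to-node incidence matrix with the slack column removed, $R=(A^{\mathsf T}\operatorname{diag}(r)^{-1}A)^{-1}$ and $X=(A^{\mathsf T}\operatorname{diag}(x)^{-1}A)^{-1}$. Given injections $p,q\in\mathbb R^n$, the voltages are $v=v^\bullet\mathbb 1+Rp+Xq$. Assume the following. 1. There is $\kappa\in\mathbb R$ with $q_i=\kappa p_i$ for all nodes $i$. The matrix $R+\kappa X$ is invertible; $L=(R+\kappa X)^{-1}=W\Lambda W^{\mathsf T}$ with $W$ orthogonal, $\Lambda=\operatorname{diag}(\lambda_1,\dots,\lambda_n)$, $\lambda_1\le\dots\le\lambda_n$. Write $w_i$ for the $i$-th row of $W$. 2. In round $t=1,\dots,m$ (where $m\ge1$) the injections are $p_t=p_\star+\tilde p_t$. Given the information $\mathcal F_{t-1}$ available before round $t$, the components of $\tilde p_t$ are conditionally independent and integrable with conditional mean $0$, and $\underline p_t\le\tilde p_t\le\overline p_t$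 almost surely, where $\underline p_t,\overline p_t$ are $\mathcal F_{t-1}$-measurable and $\overline p_{t,i}-\underline p_{t,i}\le\Delta$ for a constant $\Delta$. 3. For every line $e=(i,j)$ with $r_e+\kappa x_e<0$, the number $|r_e+\kappa x_e|$ is at least the effective resistance between $i$ and $j$ in the subnetwork of the lines $e'$ with $r_{e'}+\kappa x_{e'}>0$, taken as resistances. This effective resistance is $(e_i-e_j)^{\mathsf T}L_+^\dagger(e_i-e_j)$, with $L_+$ the Laplacian of the subnetwork, if $i$ and $j$ are connected in it, and $+\infty$ otherwise. Put $\psi_\star=\Lambda^{-1}W^{\mathsf T}p_\star$ and $\sigma_\star=\tfrac12\Delta\|R+\kappa X\|_{\mathrm{op}}$, and let $C\ge\|\psi_\star\|_\Lambda$, where $\|w\|_M=\sqrt{w^{\mathsf T}Mw}$. In round $t$ an $\mathcal F_{t-1}$-measurable set $S_t\subseteq\mathcal N$ is selected and $y_{t,i}=(v_t)_i-v^\bullet$ is observed for $i\in S_t$ (and is known at time $t$). Let $$V_t=\Lambda+\sum_{s=1}^{t}\sum_{i\in S_s}w_iw_i^{\mathsf T},\qquad \hat\psi_t=V_{t-1}^{-1}\sum_{s=1}^{t-1}\sum_{i\in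 S_s}y_{s,i}\,w_i,$$ so that $\hat\psi_t$ is the minimizer of $\sum_{s<t}\sum_{i\in S_s}(y_{s,i}-\langle w_i,\psi\rangle)^2+\|\psi\|_\Lambda^2$. Let $$d=\max\Big\{i\in\mathcal N:(i-1)\lambda_i\le \frac{m}{\log(1+m/\lambda_1)}\Big\}$$ be the effective dimension of $L$. **Theorem.** There is a universal constant $K>0$ such that in every such setting and for every $\delta\in(0,1)$ the following hold. (a) With probability at least $1-\delta$, for all $t=1,\dots,m$ and all $w\in\mathbb R^n$, $$|w^{\mathsf T}(\hat\psi_t-\psi_\star)|\le c_t\,\|w\|_{V_{t-1}^{-1}},\qquad c_t=\sigma_\star\sqrt{2\log\frac{\det(V_{t-1})^{1/2}}{\delta\det(\Lambda)^{1/2}}}+C,$$ and $c_t$ is surely at most the deterministic constant $\sigma_\star\sqrt{\sum_{i=1}^n\log(1+\tfrac{t-1}{\lambda_i})+2\log\tfrac1\delta}+C$. (b) Suppose that $|w_i^{\mathsf T}\psi_\star|\le1$ for all $i\in\mathcal N$, and that the sampler selects one node per round ($b=1$), $S_t=\{i_t\}$ with $$i_t\in\operatorname*{arg\,max}_{i\in\mathcal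 N}\ |w_i^{\mathsf T}\hat\psi_t|+c\,\|w_i\|_{V_{t-1}^{-1}},\qquad c=2\sigma_\star\sqrt{d\log(1+m/\lambda_1)+2\log(1/\delta)}+C,$$ ties being broken arbitrarily. Then, with the reward $f(S)=\max_{i\in S}|\langle w_i,\psi_\star\rangle|$ (and $f(\varnothing)=0$), the regret $$R_m=\mathbb E\Big[\max_{|S|\le1}\sum_{t=1}^m\big(f(S)-f(S_t)\big)\Big]$$ is well defined and satisfies $$R_m\le K(1+\sigma_\star+C)\;d\,\sqrt m\;\Big(1+\log\big(1+\tfrac{m}{\lambda_1}\big)+\log\tfrac1\delta\Big)=\tilde{\mathcal O}(d\sqrt m).$$ -/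

import Mathlib

open MeasureTheory ProbabilityTheory Matrix
open scoped Matrix ENNReal

noncomputable section

namespace SpectralSampling

/-! ### The distribution network and its linear power flow model -/

/-- A single-phase radial network: bus `0` is the slack bus, the buses `1, …, n` are the nodes, and
the `n` lines (with nonzero resistances `r` and reactances `x`) form a tree on all buses. -/
structure RadialNetwork (n : ℕ) where
  src : Fin n → Fin (n + 1)
  dst : Fin n → Fin (n + 1)
  radial : (SimpleGraph.fromEdgeSet (Set.range fun e => s(src e, dst e))).IsTree
  r : Fin n → ℝ
  x : Fin n → ℝ
  r_ne_zero : ∀ e, r e ≠ 0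
  x_ne_zero : ∀ e, x e ≠ 0

/-- Moore–Penrose pseudoinverse of a real symmetric matrix, through its spectral decomposition
(recall that `0⁻¹ = 0`). -/
def symmPinv {k : ℕ} (A : Matrix (Fin k) (Fin k) ℝ) (hA : A.IsHermitian) :
    Matrix (Fin k) (Fin k) ℝ :=
  (hA.eigenvectorUnitary : Matrix (Fin k) (Fin k) ℝ) * diagonal (fun i => (hA.eigenvalues i)⁻¹) *
    (hA.eigenvectorUnitary : Matrix (Fin k) (Fin k) ℝ)ᵀ

/-- The four Penrose equations, which characterize the pseudoinverse. -/
theorem symmPinv_penrose {k : ℕ} (A : Matrix (Fin k) (Fin k) ℝ) (hA : A.IsHermitian) :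
    A * symmPinv A hA * A = A ∧ symmPinv A hA * A * symmPinv A hA = symmPinv A hA ∧
      (A * symmPinv A hA)ᵀ = A * symmPinv A hA ∧ (symmPinv A hA * A)ᵀ = symmPinv A hA * A := by
  obtain ⟨U, hU⟩ : ∃ U : Matrix (Fin k) (Fin k) ℝ,
      U = (hA.eigenvectorUnitary : Matrix (Fin k) (Fin k) ℝ) := ⟨_, rfl⟩
  have hUU : Uᵀ * U = 1 := by
    have h := Unitary.coe_star_mul_self hA.eigenvectorUnitary
    rw [hU]
    simpa [star_eq_conjTranspose, conjTranspose_eq_transpose_of_trivial] using h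
  have hAe : A = U * diagonal hA.eigenvalues * Uᵀ := by
    have h := hA.spectral_theorem
    rw [Unitary.conjStarAlgAut_apply] at h
    rw [hU]
    simpa [star_eq_conjTranspose, conjTranspose_eq_transpose_of_trivial, Function.comp_def]
      using h
  have hP : symmPinv A hA = U * diagonal (fun i => (hA.eigenvalues i)⁻¹) * Uᵀ := by
    rw [hU]; rfl
  have key : ∀ D E : Matrix (Fin k) (Fin k) ℝ,
      (U * D * Uᵀ) * (U * E * Uᵀ) = U * (D * E) * Uᵀ := by
    intro D E
    calc (U * D * Uᵀ) * (U * E * Uᵀ) = U * D * (Uᵀ * U) * E * Uᵀ := by noncomm_ring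
      _ = U * (D * E) * Uᵀ := by rw [hUU]; noncomm_ring
  generalize hA.eigenvalues = ev at *
  rw [hP, hAe]
  simp only [key, diagonal_mul_diagonal]
  refine ⟨?_, ?_, ?_, ?_⟩
  · congr 3; ext i; by_cases h : ev i = 0 <;> simp [h]
  · congr 3; ext i; by_cases h : ev i = 0 <;> simp [h]
  · simp [transpose_mul, Matrix.mul_assoc]
  · simp [transpose_mul, Matrix.mul_assoc]

namespace RadialNetwork

variable {n : ℕ} (net : RadialNetwork n)

/-- Edge-to-node incidence matrix with the column of the slack bus removed. -/
def incidence : Matrix (Fin n) (Fin n) ℝ :=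
  Matrix.of fun e i =>
    (if net.src e = i.succ then 1 else 0) - (if net.dst e = i.succ then 1 else 0)

/-- `R = G⁻¹` with `G = Aᵀ diag(r)⁻¹ A`. -/
def R : Matrix (Fin n) (Fin n) ℝ :=
  (net.incidenceᵀ * (diagonal net.r)⁻¹ * net.incidence)⁻¹

/-- `X = B⁻¹` with `B = Aᵀ diag(x)⁻¹ A`. -/
def X : Matrix (Fin n) (Fin n) ℝ :=
  (net.incidenceᵀ * (diagonal net.x)⁻¹ * net.incidence)⁻¹

/-- The linear power flow model `v = v• 𝟙 + R p + X q`. -/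
def voltage (vnom : ℝ) (p q : Fin n → ℝ) : Fin n → ℝ :=
  fun i => vnom + (net.R *ᵥ p) i + (net.X *ᵥ q) i

/-- The matrix `R + κ X`, which is `L⁻¹`. -/
def sensitivity (κ : ℝ) : Matrix (Fin n) (Fin n) ℝ := net.R + κ • net.X

/-- The system Laplacian `L = (R + κ X)⁻¹`. -/
def laplacian (κ : ℝ) : Matrix (Fin n) (Fin n) ℝ := (net.sensitivity κ)⁻¹

/-- Effective line impedance `r + κ x`. -/
def lineImpedance (κ : ℝ) (e : Fin n) : ℝ := net.r e + κ * net.x e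

/-- The subnetwork of the lines with positive `r + κ x`, on all buses. -/
def posGraph (κ : ℝ) : SimpleGraph (Fin (n + 1)) :=
  SimpleGraph.fromEdgeSet {a | ∃ e, 0 < net.lineImpedance κ e ∧ a = s(net.src e, net.dst e)}

/-- The vector `e_i - e_j`. -/
def basisDiff (i j : Fin (n + 1)) : Fin (n + 1) → ℝ := Pi.single i 1 - Pi.single j 1

open Classical in
/-- Weighted Laplacian `L₊` of the subnetwork of the lines with positive `r + κ x`. -/
def posLaplacian (κ : ℝ) : Matrix (Fin (n + 1)) (Fin (n + 1)) ℝ :=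
  ∑ e ∈ Finset.univ.filter (fun e => 0 < net.lineImpedance κ e),
    (net.lineImpedance κ e)⁻¹ •
      vecMulVec (basisDiff (net.src e) (net.dst e)) (basisDiff (net.src e) (net.dst e))

theorem posLaplacian_isHermitian (κ : ℝ) : (net.posLaplacian κ).IsHermitian := by
  unfold posLaplacian Matrix.IsHermitian
  rw [conjTranspose_sum]
  refine Finset.sum_congr rfl fun e _ => ?_
  ext i j
  simp [vecMulVec_apply, mul_comm]

open Classical in
/-- Effective resistance `e_{ij}ᵀ L₊† e_{ij}` between two buses of the subnetwork of the lines with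
positive `r + κ x`; it is infinite if the subnetwork does not connect the two buses. -/
def effectiveResistance (κ : ℝ) (i j : Fin (n + 1)) : EReal :=
  if (net.posGraph κ).Reachable i j then
    ((basisDiff i j ⬝ᵥ
      (symmPinv (net.posLaplacian κ) (net.posLaplacian_isHermitian κ) *ᵥ basisDiff i j) : ℝ) :
        EReal)
  else ⊤

/-- Each line with negative `r + κ x` has `|r + κ x|` at least the effective resistance between its
ends in the subnetwork of the lines with positive `r + κ x`. -/
def EffectiveResistanceBound (κ : ℝ) : Prop :=
  ∀ e, net.lineImpedance κ e < 0 →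
    net.effectiveResistance κ (net.src e) (net.dst e) ≤ ((|net.lineImpedance κ e| : ℝ) : EReal)

end RadialNetwork

/-- `W` is an orthonormal eigenbasis of `L` (columns), with the eigenvalues in increasing order. -/
structure IsFourierBasis {n : ℕ} (L W : Matrix (Fin n) (Fin n) ℝ) (lam : Fin n → ℝ) : Prop where
  orthonormal : Wᵀ * W = 1
  decomp : L = W * diagonal lam * Wᵀ
  sorted : Monotone lam

/-- The effective dimension: the largest `i ∈ {1, …, n}` with
`(i - 1) λ_i ≤ m / log (1 + m / λ₁)`. -/
def effectiveDim {n : ℕ} [NeZero n] (lam : Fin n → ℝ) (m : ℕ) : ℕ :=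
  open Classical in
  (Finset.univ.filter fun i : Fin n =>
    (i.val : ℝ) * lam i ≤ (m : ℝ) / Real.log (1 + (m : ℝ) / lam 0)).sup fun i => i.val + 1

/-! ### Rewards and regret -/

/-- `max_{i ∈ S} g i`, with value `0` for the empty selection. -/
def maxOver {n : ℕ} (g : Fin n → ℝ) (S : Finset (Fin n)) : ℝ :=
  if h : S.Nonempty then S.sup' h g else 0

/-- The reward `f(S) = max_{i ∈ S} |⟨w_i, ψ⟩|`, where `w_i` is the `i`-th row of `W`. -/
def reward {n : ℕ} (W : Matrix (Fin n) (Fin n) ℝ) (ψ : Fin n → ℝ) (S : Finset (Fin n)) : ℝ :=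
  maxOver (fun i => |W i ⬝ᵥ ψ|) S

/-- The action set `{S ⊆ {1, …, n} : |S| ≤ b}`. -/
def actionSet (n b : ℕ) : Finset (Finset (Fin n)) :=
  Finset.univ.filter fun S => S.card ≤ b

theorem actionSet_nonempty (n b : ℕ) : (actionSet n b).Nonempty :=
  ⟨∅, by simp [actionSet]⟩

/-- Pathwise regret `max_{S ∈ 𝒜} ∑_{t=1}^m (f(S) - f(S_t))`. -/
def pathRegret {n : ℕ} (b m : ℕ) (W : Matrix (Fin n) (Fin n) ℝ) (ψ : Fin n → ℝ)
    (S : ℕ → Finset (Fin n)) : ℝ :=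
  (actionSet n b).sup' (actionSet_nonempty n b) fun S' =>
    ∑ t ∈ Finset.Icc 1 m, (reward W ψ S' - reward W ψ (S t))

/-- The regret `R_m = 𝔼[max_{S ∈ 𝒜} ∑_{t=1}^m (f(S) - f(S_t))]` of a random selection process. -/
def regret {n : ℕ} {Ω : Type*} [MeasurableSpace Ω] (μ : Measure Ω) (b m : ℕ)
    (W : Matrix (Fin n) (Fin n) ℝ) (ψ : Fin n → ℝ) (S : ℕ → Ω → Finset (Fin n)) : ℝ :=
  ∫ ω, pathRegret b m W ψ (fun t => S t ω) ∂μ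

/-! ### Spectral-regularized least squares -/

/-- The norm `‖w‖_A = √(wᵀ A w)`. -/
def matNorm {n : ℕ} (A : Matrix (Fin n) (Fin n) ℝ) (w : Fin n → ℝ) : ℝ :=
  Real.sqrt (w ⬝ᵥ (A *ᵥ w))

/-- The Gram matrix `V_t = Λ + ∑_{s=1}^t ∑_{i ∈ S_s} w_i w_iᵀ`. -/
def gram {n : ℕ} (lam : Fin n → ℝ) (W : Matrix (Fin n) (Fin n) ℝ) (S : ℕ → Finset (Fin n))
    (t : ℕ) : Matrix (Fin n) (Fin n) ℝ :=
  diagonal lam + ∑ s ∈ Finset.Icc 1 t, ∑ i ∈ S s, vecMulVec (W i) (W i)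

/-- The spectral-regularized least-squares objective of round `t`, with the observations `y s i`
(`i ∈ S_s`, `s < t`). -/
def lsObjective {n : ℕ} (lam : Fin n → ℝ) (W : Matrix (Fin n) (Fin n) ℝ)
    (S : ℕ → Finset (Fin n)) (y : ℕ → Fin n → ℝ) (t : ℕ) (ψ : Fin n → ℝ) : ℝ :=
  ∑ s ∈ Finset.Icc 1 (t - 1), ∑ i ∈ S s, (y s i - W i ⬝ᵥ ψ) ^ 2 + matNorm (diagonal lam) ψ ^ 2

/-- The least-squares estimate `ψ̂_t = V_{t-1}⁻¹ ∑_{s<t} ∑_{i ∈ S_s} y_{s,i} w_i`, the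
minimizer of `lsObjective` (see `estimate_isMinOn`). -/
def estimate {n : ℕ} (lam : Fin n → ℝ) (W : Matrix (Fin n) (Fin n) ℝ)
    (S : ℕ → Finset (Fin n)) (y : ℕ → Fin n → ℝ) (t : ℕ) : Fin n → ℝ :=
  (gram lam W S (t - 1))⁻¹ *ᵥ ∑ s ∈ Finset.Icc 1 (t - 1), ∑ i ∈ S s, y s i • W i

theorem dotProduct_gram_mulVec {n : ℕ} (lam : Fin n → ℝ) (W : Matrix (Fin n) (Fin n) ℝ)
    (S : ℕ → Finset (Fin n)) (t : ℕ) (a b : Fin n → ℝ) :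
    a ⬝ᵥ (gram lam W S t *ᵥ b) = a ⬝ᵥ (diagonal lam *ᵥ b) +
      ∑ s ∈ Finset.Icc 1 t, ∑ i ∈ S s, (W i ⬝ᵥ a) * (W i ⬝ᵥ b) := by
  unfold gram
  simp only [add_mulVec, dotProduct_add, sum_mulVec, dotProduct_sum, vecMulVec_mulVec]
  congr 1
  refine Finset.sum_congr rfl fun s _ => Finset.sum_congr rfl fun i _ => ?_
  simp [dotProduct_comm a, mul_comm]

theorem estimate_isMinOn {n : ℕ} (lam : Fin n → ℝ) (hlam : ∀ i, 0 < lam i)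
    (W : Matrix (Fin n) (Fin n) ℝ) (S : ℕ → Finset (Fin n)) (y : ℕ → Fin n → ℝ) (t : ℕ) :
    IsMinOn (lsObjective lam W S y t) Set.univ (estimate lam W S y t) := by
  have hΛ : ∀ a : Fin n → ℝ, a ⬝ᵥ (diagonal lam *ᵥ a) = ∑ i, lam i * a i ^ 2 := by
    intro a
    simp only [dotProduct, mulVec_diagonal]
    exact Finset.sum_congr rfl fun i _ => by ring
  have hΛ0 : ∀ a : Fin n → ℝ, 0 ≤ a ⬝ᵥ (diagonal lam *ᵥ a) := by
    intro a
    rw [hΛ]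
    exact Finset.sum_nonneg fun i _ => mul_nonneg (hlam i).le (sq_nonneg _)
  have hunit : IsUnit (gram lam W S (t - 1)) := by
    rw [← mulVec_injective_iff_isUnit]
    refine (injective_iff_map_eq_zero (gram lam W S (t - 1)).mulVecLin).2 fun a ha => ?_
    have h0 := dotProduct_gram_mulVec lam W S (t - 1) a a
    rw [mulVecLin_apply] at ha
    rw [ha, dotProduct_zero] at h0
    have h1 : 0 ≤ ∑ s ∈ Finset.Icc 1 (t - 1), ∑ i ∈ S s, (W i ⬝ᵥ a) * (W i ⬝ᵥ a) :=
      Finset.sum_nonneg fun s _ => Finset.sum_nonneg fun i _ => mul_self_nonneg _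
    have h2 : ∑ i, lam i * a i ^ 2 = 0 := by
      rw [← hΛ]
      linarith [hΛ0 a]
    funext i
    have h3 := (Finset.sum_eq_zero_iff_of_nonneg
      (fun i _ => mul_nonneg (hlam i).le (sq_nonneg (a i)))).1 h2 i (Finset.mem_univ i)
    simpa [(hlam i).ne'] using h3
  have hV : gram lam W S (t - 1) *ᵥ estimate lam W S y t =
      ∑ s ∈ Finset.Icc 1 (t - 1), ∑ i ∈ S s, y s i • W i := by
    rw [estimate, mulVec_mulVec, mul_nonsing_inv _ ((isUnit_iff_isUnit_det _).1 hunit), one_mulVec]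
  intro φ _
  generalize estimate lam W S y t = e at hV
  obtain ⟨d, rfl⟩ : ∃ d, φ = e + d := ⟨φ - e, by simp⟩
  have h1 := dotProduct_gram_mulVec lam W S (t - 1) d e
  rw [hV] at h1
  simp only [dotProduct_sum, dotProduct_smul, smul_eq_mul] at h1
  have hsymm : e ⬝ᵥ (diagonal lam *ᵥ d) = d ⬝ᵥ (diagonal lam *ᵥ e) := by
    simp only [dotProduct, mulVec_diagonal]
    exact Finset.sum_congr rfl fun i _ => by ring
  have hN : ∀ a, matNorm (diagonal lam) a ^ 2 = a ⬝ᵥ (diagonal lam *ᵥ a) := fun a =>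
    Real.sq_sqrt (hΛ0 a)
  have hsum : ∑ s ∈ Finset.Icc 1 (t - 1), ∑ i ∈ S s, (y s i - W i ⬝ᵥ (e + d)) ^ 2 =
      ∑ s ∈ Finset.Icc 1 (t - 1), ∑ i ∈ S s, (y s i - W i ⬝ᵥ e) ^ 2 +
      ∑ s ∈ Finset.Icc 1 (t - 1), ∑ i ∈ S s, (W i ⬝ᵥ d) ^ 2 -
      2 * (∑ s ∈ Finset.Icc 1 (t - 1), ∑ i ∈ S s, y s i * (d ⬝ᵥ W i) -
        ∑ s ∈ Finset.Icc 1 (t - 1), ∑ i ∈ S s, (W i ⬝ᵥ d) * (W i ⬝ᵥ e)) := by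
    simp only [Finset.mul_sum, ← Finset.sum_add_distrib, ← Finset.sum_sub_distrib]
    refine Finset.sum_congr rfl fun s _ => Finset.sum_congr rfl fun i _ => ?_
    rw [dotProduct_add, dotProduct_comm d (W i)]
    ring
  have hpos : 0 ≤ ∑ s ∈ Finset.Icc 1 (t - 1), ∑ i ∈ S s, (W i ⬝ᵥ d) ^ 2 :=
    Finset.sum_nonneg fun s _ => Finset.sum_nonneg fun i _ => sq_nonneg _
  show lsObjective lam W S y t e ≤ lsObjective lam W S y t (e + d)
  unfold lsObjective
  rw [hN, hN, hsum, mulVec_add, dotProduct_add, add_dotProduct, add_dotProduct, hsymm]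
  linarith [hΛ0 d]

/-- The confidence radius `c_t = σ √(2 log (det V_{t-1}^{1/2} / (δ det Λ^{1/2}))) + C`. -/
def confidenceRadius {n : ℕ} (lam : Fin n → ℝ) (W : Matrix (Fin n) (Fin n) ℝ)
    (σ C δ : ℝ) (S : ℕ → Finset (Fin n)) (t : ℕ) : ℝ :=
  σ * Real.sqrt (2 * Real.log
    (Real.sqrt (gram lam W S (t - 1)).det / (δ * Real.sqrt (diagonal lam).det))) + C

/-! ### The sampler -/

/-- The exploration parameter of the sampler. -/
def explorationParam {n : ℕ} [NeZero n] (lam : Fin n → ℝ) (m : ℕ) (σ C δ : ℝ) : ℝ :=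
  2 * σ * Real.sqrt (effectiveDim lam m * Real.log (1 + (m : ℝ) / lam 0) + 2 * Real.log (1 / δ))
    + C

/-- The optimistic reward `f̃(S) = max_{i ∈ S} (|⟨w_i, ψ̂⟩| + c ‖w_i‖_{V⁻¹})`. -/
def optimisticReward {n : ℕ} (W V : Matrix (Fin n) (Fin n) ℝ) (ψ : Fin n → ℝ) (c : ℝ)
    (S : Finset (Fin n)) : ℝ :=
  maxOver (fun i => |W i ⬝ᵥ ψ| + c * matNorm V⁻¹ (W i)) S

/-- `GreedySelection f k S`: the set `S` is an outcome of `k` greedy steps that each add a node of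
largest marginal gain of `f` (ties are broken arbitrarily). -/
inductive GreedySelection {n : ℕ} (f : Finset (Fin n) → ℝ) : ℕ → Finset (Fin n) → Prop
  | zero : GreedySelection f 0 ∅
  | succ (i : ℕ) (S : Finset (Fin n)) (k : Fin n) (hS : GreedySelection f i S)
      (hk : ∀ j, f (insert j S) - f S ≤ f (insert k S) - f S) :
      GreedySelection f (i + 1) (insert k S)

/-- `S` is a run over `m` rounds, with `b` nodes per round and exploration parameter `c`, of the
spectral sampler on the observations `y`. -/
def IsSamplerRun {n : ℕ} (lam : Fin n → ℝ) (W : Matrix (Fin n) (Fin n) ℝ) (c : ℝ) (b m : ℕ)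
    (y : ℕ → Fin n → ℝ) (S : ℕ → Finset (Fin n)) : Prop :=
  ∀ t ∈ Finset.Icc 1 m,
    GreedySelection (optimisticReward W (gram lam W S (t - 1)) (estimate lam W S y t) c) b (S t)

/-! ### The stochastic model -/

/-- All nodes have the same ratio `κ` of reactive to active injections. -/
def UniformRatio {n : ℕ} (κ : ℝ) (p q : Fin n → ℝ) : Prop :=
  ∀ i, q i = κ * p i

/-- The injection fluctuations `ptil t` (`t = 1, …, m`) are noise, independent across the nodes
given the past, with predictable ranges `[lo t, hi t]` of width at most `Δ`. -/
structure PredictableRanges {n : ℕ} {Ω : Type*} [mΩ : MeasurableSpace Ω] [StandardBorelSpace Ω]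
    (μ : Measure Ω) [IsFiniteMeasure μ] (F : Filtration ℕ mΩ) (m : ℕ)
    (ptil lo hi : ℕ → Ω → Fin n → ℝ) (Δ : ℝ) : Prop where
  measurable : ∀ t ∈ Finset.Icc 1 m, ∀ i, Measurable fun ω => ptil t ω i
  integrable : ∀ t ∈ Finset.Icc 1 m, ∀ i, Integrable (fun ω => ptil t ω i) μ
  centered : ∀ t ∈ Finset.Icc 1 m, ∀ i, μ[fun ω => ptil t ω i | F (t - 1)] =ᵐ[μ] 0
  indep : ∀ t ∈ Finset.Icc 1 m,
    iCondIndepFun (F (t - 1)) (F.le (t - 1)) (fun i ω => ptil t ω i) μ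
  lo_predictable : ∀ t ∈ Finset.Icc 1 m, ∀ i, Measurable[F (t - 1)] fun ω => lo t ω i
  hi_predictable : ∀ t ∈ Finset.Icc 1 m, ∀ i, Measurable[F (t - 1)] fun ω => hi t ω i
  mem_range : ∀ t ∈ Finset.Icc 1 m, ∀ᵐ ω ∂μ, ∀ i, lo t ω i ≤ ptil t ω i ∧ ptil t ω i ≤ hi t ω i
  width_le : ∀ t ∈ Finset.Icc 1 m, ∀ᵐ ω ∂μ, ∀ i, hi t ω i - lo t ω i ≤ Δ

open Classical in
/-- The selections are nonanticipating, and the voltages observed in a round are known after it: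
`S t` is `F (t-1)`-measurable and the values `v t i`, `i ∈ S t`, are `F t`-measurable. -/
structure Nonanticipating {n : ℕ} {Ω : Type*} [mΩ : MeasurableSpace Ω] (F : Filtration ℕ mΩ)
    (m : ℕ) (v : ℕ → Ω → Fin n → ℝ) (S : ℕ → Ω → Finset (Fin n)) : Prop where
  selection : ∀ t ∈ Finset.Icc 1 m, ∀ A, MeasurableSet[F (t - 1)] {ω | S t ω = A}
  observation : ∀ t ∈ Finset.Icc 1 m, ∀ i,
    Measurable[F t] fun ω => if i ∈ S t ω then v t ω i else 0

end SpectralSampling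

end

/-! Write M for R + κX. In a tree, deleting a line separates its two ends, so a line with negative r
+ κx would face an infinite effective resistance and assumption 3 excludes it; invertibility of M
excludes r + κx = 0. Since R and X are congruent to diag(r) and diag(x) through the same A⁻¹, M is
positive definite (`posDef_sensitivity`) and every λ_i is positive. As Wψ⋆ = Mp⋆, the observations
form a linear regression y_{t,i} = ⟨w_i, ψ⋆⟩ + (M p̃_t)_i.

The entries of M p̃_t are correlated, but a combination of them with coefficients u is a combination
of the conditionally independent entries of p̃_t with coefficients Mu. Hoeffding's lemma bounds its
conditional log-mgf by Δ²‖Mu‖²/8 ≤ σ⋆²‖u‖²/2. With z_t the sum of the noise terms η_{s,i} w_i in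
units of σ⋆, the process exp(⟨x, z_t⟩ - xᵀV_t x/2) is therefore a nonnegative supermartingale for
each x. Integrated over x, where the Λ inside V_t plays the Gaussian prior, it equals
exp(‖z_t‖²/2)/√det V_t up to a constant, in the norm of V_t⁻¹. Ville's inequality controls all
rounds at once, and the regularization bias adds at most ‖ψ⋆‖_Λ ≤ C. This is (a).

For (b), optimism bounds the regret of a round by min(1, 2c‖w_{i_t}‖), in the norm of V_{t-1}⁻¹.
Cauchy–Schwarz and the elliptical potential reduce the sum to log(det V_m/det Λ), which is at most
2d log(1 + m/λ₁) (`log_det_gram_le_effectiveDim`). Since R_m is an expectation and δ is arbitrary,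
the ellipsoids are used at level (1 + m/λ₁)⁻¹ instead of δ: c dominates the radius at that level,
and the failure event, where the regret is at most mC/√λ₁, costs only C√m. -/

noncomputable section

namespace SpectralSampling

/-! ### Radial networks: positivity of the line impedances and of R + κX -/

namespace RadialNetwork

variable {n : ℕ} (net : RadialNetwork n)

/-- `Fin.cons 0 x` is the potential on all buses that is grounded at the slack bus; the incidence
matrix takes its drops along the lines. -/
theorem incidence_mulVec (x : Fin n → ℝ) (e : Fin n) :
    (net.incidence *ᵥ x) e =
      (Fin.cons 0 x : Fin (n + 1) → ℝ) (net.src e) -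
        (Fin.cons 0 x : Fin (n + 1) → ℝ) (net.dst e) := by
  have h : ∀ b : Fin (n + 1), ∑ i : Fin n, (if b = i.succ then (1 : ℝ) else 0) * x i =
      (Fin.cons 0 x : Fin (n + 1) → ℝ) b := by
    intro b
    refine Fin.cases ?_ (fun j => ?_) b
    · simp [Fin.succ_ne_zero, eq_comm]
    · simp [Fin.succ_inj]
  simp only [mulVec, dotProduct, incidence, of_apply, sub_mul, Finset.sum_sub_distrib, h]

theorem _root_.SimpleGraph.Reachable.apply_eq {V α : Type*} {G : SimpleGraph V} {f : V → α}
    (hf : ∀ i j, G.Adj i j → f i = f j) {i j : V} (h : G.Reachable i j) : f i = f j := by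
  obtain ⟨p⟩ := h
  induction p with
  | nil => rfl
  | cons hadj _ ih => exact (hf _ _ hadj).trans ih

/-- A potential without a drop on any line is constant on the connected network, hence equal to its
value 0 at the slack bus. -/
theorem isUnit_incidence : IsUnit net.incidence := by
  rw [← mulVec_injective_iff_isUnit]
  refine (injective_iff_map_eq_zero net.incidence.mulVecLin).2 fun x hx => ?_
  have hx' : ∀ e, (Fin.cons 0 x : Fin (n + 1) → ℝ) (net.src e) =
      (Fin.cons 0 x : Fin (n + 1) → ℝ) (net.dst e) := by
    intro e
    rw [← sub_eq_zero, ← incidence_mulVec]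
    exact congrFun hx e
  funext i
  have := (net.radial.connected.preconnected i.succ 0).apply_eq
    (f := (Fin.cons 0 x : Fin (n + 1) → ℝ)) ?_
  · simpa using this
  · rintro a b hab
    obtain ⟨⟨e, he⟩, -⟩ := (SimpleGraph.fromEdgeSet_adj _).1 hab
    rcases Sym2.eq_iff.1 he with ⟨rfl, rfl⟩ | ⟨rfl, rfl⟩
    · exact hx' e
    · exact (hx' e).symm

/-- Removing a line of a radial network disconnects its ends. -/
theorem not_reachable_posGraph {κ : ℝ} {e : Fin n} (he : net.lineImpedance κ e < 0) :
    ¬ (net.posGraph κ).Reachable (net.src e) (net.dst e) := by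
  intro h
  -- A potential with unit drop on `e` and no drop on any other line. It is constant along paths of
  -- the positive subnetwork, which avoids `e`.
  obtain ⟨x, hx⟩ : ∃ x, net.incidence *ᵥ x = Pi.single e 1 :=
    (mulVec_surjective_iff_isUnit.2 net.isUnit_incidence) _
  have key : ∀ e', e' ≠ e → (Fin.cons 0 x : Fin (n + 1) → ℝ) (net.src e') =
      (Fin.cons 0 x : Fin (n + 1) → ℝ) (net.dst e') := by
    intro e' he'
    rw [← sub_eq_zero, ← incidence_mulVec, hx, Pi.single_eq_of_ne he']
  have h1 := h.apply_eq (f := (Fin.cons 0 x : Fin (n + 1) → ℝ)) ?_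
  · have h2 := net.incidence_mulVec x e
    rw [hx, Pi.single_eq_same, h1, sub_self] at h2
    exact one_ne_zero h2
  · intro a b hab
    obtain ⟨⟨e', hpos, he'⟩, -⟩ := (SimpleGraph.fromEdgeSet_adj _).1 hab
    have hne : e' ≠ e := by
      rintro rfl
      exact lt_asymm he hpos
    rcases Sym2.eq_iff.1 he' with ⟨rfl, rfl⟩ | ⟨rfl, rfl⟩
    · exact key e' hne
    · exact (key e' hne).symm

theorem inv_transpose_mul_diagonal_inv_mul {A : Matrix (Fin n) (Fin n) ℝ} {z : Fin n → ℝ}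
    (hz : ∀ e, z e ≠ 0) :
    (Aᵀ * (diagonal z)⁻¹ * A)⁻¹ = A⁻¹ * diagonal z * A⁻¹ᵀ := by
  have : IsUnit (diagonal z).det := by
    rw [det_diagonal]
    exact (Finset.prod_ne_zero_iff.2 fun e _ => hz e).isUnit
  rw [Matrix.mul_inv_rev, Matrix.mul_inv_rev, nonsing_inv_nonsing_inv _ this, transpose_nonsing_inv,
    Matrix.mul_assoc]

/-- R and X are congruent to diagonal matrices through the same matrix A⁻¹, so their combination is
too. -/
theorem sensitivity_eq (κ : ℝ) :
    net.sensitivity κ = net.incidence⁻¹ * diagonal (net.lineImpedance κ) * net.incidence⁻¹ᵀ := by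
  have : diagonal (net.lineImpedance κ) = diagonal net.r + κ • diagonal net.x := by
    ext i j
    by_cases h : i = j
    · subst h; simp [lineImpedance]
    · simp [h]
  rw [sensitivity, R, X, inv_transpose_mul_diagonal_inv_mul net.r_ne_zero,
    inv_transpose_mul_diagonal_inv_mul net.x_ne_zero, this, Matrix.mul_add, Matrix.add_mul,
    Matrix.mul_smul, Matrix.smul_mul]

/-- A zero entry would make the determinant vanish, and a negative one would need a finite number to
dominate the resistance `⊤` between disconnected buses. -/
theorem lineImpedance_pos {κ : ℝ} (hunit : IsUnit (net.sensitivity κ))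
    (hres : net.EffectiveResistanceBound κ) (e : Fin n) : 0 < net.lineImpedance κ e := by
  have h0 : net.lineImpedance κ e ≠ 0 := by
    intro h
    rw [isUnit_iff_isUnit_det, sensitivity_eq, det_mul, det_mul, det_diagonal,
      Finset.prod_eq_zero (Finset.mem_univ e) h] at hunit
    simp at hunit
  rcases lt_or_gt_of_ne h0 with hneg | hpos
  · have h := hres e hneg
    rw [effectiveResistance, if_neg (net.not_reachable_posGraph hneg)] at h
    exact absurd (top_le_iff.1 h) (EReal.coe_ne_top _)
  · exact hpos

theorem posDef_sensitivity {κ : ℝ} (hunit : IsUnit (net.sensitivity κ))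
    (hres : net.EffectiveResistanceBound κ) : (net.sensitivity κ).PosDef := by
  rw [sensitivity_eq]
  have hu : IsUnit net.incidence⁻¹ := (isUnit_nonsing_inv_iff).2 net.isUnit_incidence
  have := (PosDef.diagonal (net.lineImpedance_pos hunit hres)).mul_mul_conjTranspose_same
    (B := net.incidence⁻¹) (vecMul_injective_iff_isUnit.2 hu)
  rwa [conjTranspose_eq_transpose_of_trivial] at this

end RadialNetwork

/-! ### The graph Fourier basis -/

namespace IsFourierBasis

variable {n : ℕ} {L W : Matrix (Fin n) (Fin n) ℝ} {lam : Fin n → ℝ}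

theorem mul_transpose (h : IsFourierBasis L W lam) : W * Wᵀ = 1 :=
  mul_eq_one_comm.1 h.orthonormal

theorem eigenvalue_pos (h : IsFourierBasis L W lam) (hL : L.PosDef) (i : Fin n) : 0 < lam i := by
  have hinj : Function.Injective W.mulVec := mulVec_injective_iff_isUnit.2
    (IsUnit.of_mul_eq_one Wᵀ h.mul_transpose)
  have h1 := hL.conjTranspose_mul_mul_same hinj
  have h2 : Wᵀ * (W * diagonal lam * Wᵀ) * W = (Wᵀ * W) * diagonal lam * (Wᵀ * W) := by
    simp only [Matrix.mul_assoc]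
  rw [conjTranspose_eq_transpose_of_trivial, h.decomp, h2, h.orthonormal, Matrix.one_mul,
    Matrix.mul_one] at h1
  exact posDef_diagonal_iff.1 h1 i

theorem inv_eq (h : IsFourierBasis L W lam) (hlam : ∀ i, 0 < lam i) :
    L⁻¹ = W * diagonal (fun i => (lam i)⁻¹) * Wᵀ := by
  apply inv_eq_right_inv
  rw [h.decomp]
  calc W * diagonal lam * Wᵀ * (W * diagonal (fun i => (lam i)⁻¹) * Wᵀ)
      = W * (diagonal lam * (Wᵀ * W) * diagonal (fun i => (lam i)⁻¹)) * Wᵀ := by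
        simp only [Matrix.mul_assoc]
    _ = 1 := by
        rw [h.orthonormal, Matrix.mul_one, diagonal_mul_diagonal]
        simp [(hlam _).ne', h.mul_transpose]

end IsFourierBasis

/-! ### Positive definite matrices: determinants and weighted norms -/

section PosDef

variable {n : ℕ}

/-- Multiply the inequalities x ≤ exp(x - 1) over the eigenvalues. -/
theorem _root_.Matrix.PosDef.det_le_exp_trace_sub {P : Matrix (Fin n) (Fin n) ℝ} (hP : P.PosDef) :
    P.det ≤ Real.exp (P.trace - n) := by
  rw [hP.isHermitian.det_eq_prod_eigenvalues, hP.isHermitian.trace_eq_sum_eigenvalues]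
  have h : (∑ i, hP.isHermitian.eigenvalues i) - n = ∑ i, (hP.isHermitian.eigenvalues i - 1) := by
    simp
  simp only [RCLike.ofReal_real_eq_id, id]
  rw [h, Real.exp_sum]
  exact Finset.prod_le_prod (fun i _ => (hP.eigenvalues_pos i).le) fun i _ => by
    linarith [Real.add_one_le_exp (hP.isHermitian.eigenvalues i - 1)]

/-- **Hadamard's inequality** for positive definite matrices. -/
theorem _root_.Matrix.PosDef.det_le_prod_diag {V : Matrix (Fin n) (Fin n) ℝ} (hV : V.PosDef) :
    V.det ≤ ∏ i, V i i := by
  have hpos : ∀ i, 0 < V i i := fun i => hV.diag_pos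
  -- Rescaling to unit diagonal makes the trace equal to n, so that the exponential bound on the
  -- determinant becomes 1.
  set s : Fin n → ℝ := fun i => (Real.sqrt (V i i))⁻¹ with hs
  have hs0 : ∀ i, s i ≠ 0 := fun i => inv_ne_zero (Real.sqrt_pos.2 (hpos i)).ne'
  have hss : ∀ i, s i * V i i * s i = 1 := by
    intro i
    have := Real.mul_self_sqrt (hpos i).le
    have h' := (Real.sqrt_pos.2 (hpos i)).ne'
    simp only [hs]
    field_simp
    rw [sq, this]
  have hu : IsUnit (diagonal s) := by
    rw [isUnit_iff_isUnit_det, det_diagonal]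
    exact (Finset.prod_ne_zero_iff.2 fun e _ => hs0 e).isUnit
  have hP := hV.conjTranspose_mul_mul_same (B := diagonal s) (mulVec_injective_iff_isUnit.2 hu)
  rw [conjTranspose_eq_transpose_of_trivial, diagonal_transpose] at hP
  have h1 := hP.det_le_exp_trace_sub
  have ht : (diagonal s * V * diagonal s).trace = n := by
    simp [trace, mul_diagonal, diagonal_mul, hss]
  rw [ht, sub_self, Real.exp_zero, det_mul, det_mul, det_diagonal] at h1
  have h2 : (∏ i, s i) * (∏ i, V i i) * ∏ i, s i = 1 := by
    rw [← Finset.prod_mul_distrib, ← Finset.prod_mul_distrib, Finset.prod_congr rfl fun i _ => hss i,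
      Finset.prod_const_one]
  have h3 : 0 < (∏ i, s i) * (∏ i, s i) :=
    mul_self_pos.2 (Finset.prod_ne_zero_iff.2 fun e _ => hs0 e)
  have h4 : ((∏ i, s i) * (∏ i, s i)) * V.det ≤ ((∏ i, s i) * (∏ i, s i)) * ∏ i, V i i := by
    linarith
  exact le_of_mul_le_mul_left h4 h3

theorem matNorm_nonneg (P : Matrix (Fin n) (Fin n) ℝ) (a : Fin n → ℝ) : 0 ≤ matNorm P a :=
  Real.sqrt_nonneg _

theorem matNorm_sq {P : Matrix (Fin n) (Fin n) ℝ} (hP : P.PosDef) (a : Fin n → ℝ) :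
    matNorm P a ^ 2 = a ⬝ᵥ (P *ᵥ a) :=
  Real.sq_sqrt (by simpa using hP.posSemidef.dotProduct_mulVec_nonneg a)

theorem dotProduct_mulVec_comm {P : Matrix (Fin n) (Fin n) ℝ} (hP : P.PosDef) (a b : Fin n → ℝ) :
    a ⬝ᵥ (P *ᵥ b) = b ⬝ᵥ (P *ᵥ a) := by
  have h : Pᵀ = P := by simpa [conjTranspose_eq_transpose_of_trivial] using hP.isHermitian.eq
  rw [dotProduct_mulVec, ← mulVec_transpose, h, dotProduct_comm]

/-- Cauchy–Schwarz, from the discriminant of the nonnegative quadratic t ↦ ‖a + tb‖². -/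
theorem abs_dotProduct_mulVec_le {P : Matrix (Fin n) (Fin n) ℝ} (hP : P.PosDef)
    (a b : Fin n → ℝ) : |a ⬝ᵥ (P *ᵥ b)| ≤ matNorm P a * matNorm P b := by
  have hq : ∀ t : ℝ, 0 ≤ (b ⬝ᵥ (P *ᵥ b)) * (t * t) + (2 * (a ⬝ᵥ (P *ᵥ b))) * t +
      a ⬝ᵥ (P *ᵥ a) := by
    intro t
    have h := hP.posSemidef.dotProduct_mulVec_nonneg (a + t • b)
    simp only [star_trivial, mulVec_add, mulVec_smul, dotProduct_add, add_dotProduct,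
      dotProduct_smul, smul_dotProduct, smul_eq_mul, dotProduct_mulVec_comm hP b a] at h
    linarith
  have hd := discrim_le_zero hq
  rw [discrim, ← matNorm_sq hP a, ← matNorm_sq hP b] at hd
  refine abs_le_of_sq_le_sq ?_ (mul_nonneg (matNorm_nonneg _ _) (matNorm_nonneg _ _))
  nlinarith

theorem matNorm_sub_le {P : Matrix (Fin n) (Fin n) ℝ} (hP : P.PosDef) (a b : Fin n → ℝ) :
    matNorm P (a - b) ≤ matNorm P a + matNorm P b := by
  refine le_of_sq_le_sq ?_ (add_nonneg (matNorm_nonneg _ _) (matNorm_nonneg _ _))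
  have h := abs_le.1 (abs_dotProduct_mulVec_le hP a b)
  have e : (matNorm P a + matNorm P b) ^ 2 =
    matNorm P a ^ 2 + 2 * (matNorm P a * matNorm P b) + matNorm P b ^ 2 := by ring
  rw [e, matNorm_sq hP, matNorm_sq hP, matNorm_sq hP, mulVec_sub, dotProduct_sub, sub_dotProduct,
    sub_dotProduct, dotProduct_mulVec_comm hP b a]
  linarith [h.1]

/-- The dual norm is antitone in the matrix. -/
theorem matNorm_inv_mulVec_le {P V : Matrix (Fin n) (Fin n) ℝ} (hP : P.PosDef) (hV : V.PosDef)
    (hPV : ∀ u : Fin n → ℝ, u ⬝ᵥ (P *ᵥ u) ≤ u ⬝ᵥ (V *ᵥ u)) (a : Fin n → ℝ) :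
    matNorm V⁻¹ (P *ᵥ a) ≤ matNorm P a := by
  have hu : IsUnit V.det := (isUnit_iff_isUnit_det _).1 hV.isUnit
  set b := P *ᵥ a with hb
  set u := V⁻¹ *ᵥ b with hu'
  have h1 : matNorm V⁻¹ b ^ 2 = u ⬝ᵥ (P *ᵥ a) := by
    rw [matNorm_sq hV.inv, dotProduct_comm]
  have h2 : u ⬝ᵥ (V *ᵥ u) = matNorm V⁻¹ b ^ 2 := by
    rw [h1, show V *ᵥ u = P *ᵥ a by rw [hu', mulVec_mulVec, mul_nonsing_inv _ hu, one_mulVec]]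
  -- The P-norm of u is at most its V-norm, which is the V⁻¹-norm of b. Cauchy–Schwarz then bounds
  -- ‖b‖² by ‖b‖ times the P-norm of a, and one factor cancels.
  have h3 : matNorm P u ≤ matNorm V⁻¹ b := by
    refine le_of_sq_le_sq ?_ (matNorm_nonneg _ _)
    rw [matNorm_sq hP, ← h2]
    exact hPV u
  have h4 : matNorm V⁻¹ b ^ 2 ≤ matNorm V⁻¹ b * matNorm P a :=
    h1 ▸ ((le_abs_self _).trans (abs_dotProduct_mulVec_le hP u a)).trans
      (mul_le_mul_of_nonneg_right h3 (matNorm_nonneg _ _))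
  rcases (matNorm_nonneg V⁻¹ b).eq_or_lt with h | h
  · rw [← h]; exact matNorm_nonneg _ _
  · nlinarith

theorem _root_.Matrix.det_add_vecMulVec_self {V : Matrix (Fin n) (Fin n) ℝ} (hV : IsUnit V.det)
    (w : Fin n → ℝ) :
    (V + vecMulVec w w).det = V.det * (1 + w ⬝ᵥ (V⁻¹ *ᵥ w)) := by
  rw [vecMulVec_eq Unit, det_add_replicateCol_mul_replicateRow hV, det_unique (n := Unit)]
  simp [Matrix.mul_assoc, Matrix.mul_apply, mulVec, dotProduct]

end PosDef

/-! ### Growth of the Gram determinant and the confidence radius -/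

section Gram

variable {n : ℕ} {lam : Fin n → ℝ} {W : Matrix (Fin n) (Fin n) ℝ} {S : ℕ → Finset (Fin n)}

theorem gram_zero : gram lam W S 0 = diagonal lam := by
  simp [gram]

theorem gram_succ (t : ℕ) :
    gram lam W S (t + 1) = gram lam W S t + ∑ i ∈ S (t + 1), vecMulVec (W i) (W i) := by
  rw [gram, gram, Finset.sum_Icc_succ_top (Nat.succ_le_succ (Nat.zero_le t)), add_assoc]

theorem gram_apply_self (t : ℕ) (i : Fin n) :
    gram lam W S t i i = lam i + ∑ s ∈ Finset.Icc 1 t, ∑ j ∈ S s, W j i ^ 2 := by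
  simp [gram, Matrix.add_apply, Matrix.sum_apply, vecMulVec_apply, sq]

theorem dotProduct_diagonal_le_gram (t : ℕ) (a : Fin n → ℝ) :
    a ⬝ᵥ (diagonal lam *ᵥ a) ≤ a ⬝ᵥ (gram lam W S t *ᵥ a) := by
  rw [dotProduct_gram_mulVec]
  exact le_add_of_nonneg_right
    (Finset.sum_nonneg fun s _ => Finset.sum_nonneg fun i _ => mul_self_nonneg _)

theorem posDef_gram (hlam : ∀ i, 0 < lam i) (t : ℕ) : (gram lam W S t).PosDef :=
  (PosDef.diagonal hlam).add_posSemidef <| posSemidef_sum _ fun s _ => posSemidef_sum _ fun i _ => by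
    simpa using posSemidef_vecMulVec_self_star (W i)

theorem sum_col_sq (hW : Wᵀ * W = 1) (i : Fin n) : ∑ j, W j i ^ 2 = 1 := by
  have := congrFun (congrFun hW i) i
  simpa [Matrix.mul_apply, sq] using this

theorem sum_row_sq (hW : W * Wᵀ = 1) (j : Fin n) : ∑ i, W j i ^ 2 = 1 := by
  have := congrFun (congrFun hW j) j
  simpa [Matrix.mul_apply, sq] using this

theorem log_det_diagonal (hlam : ∀ i, 0 < lam i) :
    Real.log (diagonal lam).det = ∑ i, Real.log (lam i) := by
  rw [det_diagonal, Real.log_prod fun i _ => (hlam i).ne']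

/-- Hadamard's inequality: only the energy collected in each spectral coordinate enters. -/
theorem log_det_gram_le (hlam : ∀ i, 0 < lam i) (t : ℕ) :
    Real.log (gram lam W S t).det - Real.log (diagonal lam).det ≤
      ∑ i, Real.log (1 + (∑ s ∈ Finset.Icc 1 t, ∑ j ∈ S s, W j i ^ 2) / lam i) := by
  have hV := posDef_gram (W := W) (S := S) hlam t
  have h := Real.log_le_log hV.det_pos hV.det_le_prod_diag
  rw [Real.log_prod fun i _ => hV.diag_pos.ne'] at h
  rw [log_det_diagonal hlam, sub_le_iff_le_add, ← Finset.sum_add_distrib]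
  refine h.trans (Finset.sum_le_sum fun i _ => le_of_eq ?_)
  have hg : 0 ≤ ∑ s ∈ Finset.Icc 1 t, ∑ j ∈ S s, W j i ^ 2 :=
    Finset.sum_nonneg fun s _ => Finset.sum_nonneg fun i _ => sq_nonneg _
  have hi := hlam i
  rw [← Real.log_mul (by positivity) hi.ne', gram_apply_self]
  congr 1
  field_simp

/-- The columns of W are unit vectors, so a round adds at most 1 to each diagonal entry, however
many nodes it selects. -/
theorem log_det_gram_le_sum_log (hlam : ∀ i, 0 < lam i) (hW : Wᵀ * W = 1) (t : ℕ) :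
    Real.log (gram lam W S t).det - Real.log (diagonal lam).det ≤
      ∑ i, Real.log (1 + t / lam i) := by
  refine (log_det_gram_le hlam t).trans (Finset.sum_le_sum fun i _ => ?_)
  have hg : 0 ≤ ∑ s ∈ Finset.Icc 1 t, ∑ j ∈ S s, W j i ^ 2 :=
    Finset.sum_nonneg fun s _ => Finset.sum_nonneg fun i _ => sq_nonneg _
  have hi := hlam i
  refine Real.log_le_log (by positivity) ?_
  gcongr
  calc ∑ s ∈ Finset.Icc 1 t, ∑ j ∈ S s, W j i ^ 2 ≤ ∑ s ∈ Finset.Icc 1 t, (1 : ℝ) := by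
        refine Finset.sum_le_sum fun s _ => ?_
        rw [← sum_col_sq hW i]
        exact Finset.sum_le_sum_of_subset_of_nonneg (Finset.subset_univ _) fun _ _ _ => sq_nonneg _
    _ = t := by simp

/-- The **elliptical potential** identity. -/
theorem sum_log_one_add_matNorm_sq (hlam : ∀ i, 0 < lam i) {k : ℕ → Fin n} {m : ℕ}
    (hS : ∀ t ∈ Finset.Icc 1 m, S t = {k t}) :
    ∑ t ∈ Finset.Icc 1 m, Real.log (1 + matNorm (gram lam W S (t - 1))⁻¹ (W (k t)) ^ 2) =
      Real.log (gram lam W S m).det - Real.log (diagonal lam).det := by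
  induction m with
  | zero => simp [gram_zero]
  | succ m ih =>
    have hV := posDef_gram (W := W) (S := S) hlam m
    rw [Finset.sum_Icc_succ_top (Nat.succ_le_succ (Nat.zero_le m)),
      ih fun t ht => hS t (Finset.Icc_subset_Icc_right (Nat.le_succ m) ht), gram_succ,
      hS (m + 1) (by simp), Finset.sum_singleton,
      det_add_vecMulVec_self ((isUnit_iff_isUnit_det _).1 hV.isUnit), Nat.add_sub_cancel,
      ← matNorm_sq hV.inv, Real.log_mul hV.det_pos.ne' (by positivity)]
    ring

theorem confidenceRadius_eq (hlam : ∀ i, 0 < lam i) {σ C δ : ℝ} (hδ : 0 < δ) (t : ℕ) :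
    confidenceRadius lam W σ C δ S t =
      σ * Real.sqrt (Real.log (gram lam W S (t - 1)).det - Real.log (diagonal lam).det +
        2 * Real.log (1 / δ)) + C := by
  have h1 := (posDef_gram (W := W) (S := S) hlam (t - 1)).det_pos
  have h2 := (PosDef.diagonal hlam).det_pos
  have h3 := Real.sqrt_pos.2 h1
  have h4 := Real.sqrt_pos.2 h2
  rw [confidenceRadius, Real.log_div h3.ne' (by positivity), Real.log_mul hδ.ne' h4.ne',
    Real.log_sqrt h1.le, Real.log_sqrt h2.le, one_div, Real.log_inv]
  ring_nf

theorem confidenceRadius_le (hlam : ∀ i, 0 < lam i) (hW : Wᵀ * W = 1) {σ C δ : ℝ} (hδ : 0 < δ)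
    (hσ : 0 ≤ σ) {t : ℕ} (ht : 1 ≤ t) :
    confidenceRadius lam W σ C δ S t ≤
      σ * Real.sqrt (∑ i, Real.log (1 + ((t : ℝ) - 1) / lam i) + 2 * Real.log (1 / δ)) + C := by
  rw [confidenceRadius_eq hlam hδ]
  have h := log_det_gram_le_sum_log (S := S) hlam hW (t - 1)
  rw [Nat.cast_sub ht, Nat.cast_one] at h
  gcongr

end Gram

/-! ### The effective dimension controls the Gram determinant -/

section EffectiveDim

variable {n : ℕ} [NeZero n] {lam : Fin n → ℝ} {m : ℕ}

theorem log_one_add_div_pos (hlam : ∀ i, 0 < lam i) (hm : 1 ≤ m) :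
    0 < Real.log (1 + (m : ℝ) / lam 0) :=
  Real.log_pos (by
    have : (0 : ℝ) < m := by exact_mod_cast hm
    have := div_pos this (hlam 0)
    linarith)

theorem one_le_effectiveDim (hlam : ∀ i, 0 < lam i) (hm : 1 ≤ m) : 1 ≤ effectiveDim lam m := by
  classical
  have h0 : (0 : Fin n) ∈ Finset.univ.filter fun i : Fin n =>
      (i.val : ℝ) * lam i ≤ (m : ℝ) / Real.log (1 + (m : ℝ) / lam 0) := by
    have := log_one_add_div_pos hlam hm
    simp only [Finset.mem_filter, Finset.mem_univ, true_and, Fin.val_zero, Nat.cast_zero, zero_mul]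
    positivity
  have h := Finset.le_sup (f := fun i : Fin n => i.val + 1) h0
  refine (Nat.le_add_left 1 _).trans (h.trans (le_of_eq ?_))
  unfold effectiveDim
  congr

/-- Counted from 0, the index d is the first one beyond the maximum that defines d, so it violates
the defining inequality; monotonicity carries this to all later indices. -/
theorem lt_effectiveDim_mul (hmono : Monotone lam) {i : Fin n} (hi : effectiveDim lam m ≤ i.val) :
    (m : ℝ) / Real.log (1 + (m : ℝ) / lam 0) < effectiveDim lam m * lam i := by
  classical
  set d := effectiveDim lam m with hd
  have hdn : d < n := hi.trans_lt i.2
  have hnot : (⟨d, hdn⟩ : Fin n) ∉ Finset.univ.filter fun i : Fin n =>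
      (i.val : ℝ) * lam i ≤ (m : ℝ) / Real.log (1 + (m : ℝ) / lam 0) := by
    intro hmem
    have h : d + 1 ≤ effectiveDim lam m := by
      have h := Finset.le_sup (f := fun i : Fin n => i.val + 1) hmem
      unfold effectiveDim
      convert h
    omega
  simp only [Finset.mem_filter, Finset.mem_univ, true_and, not_le] at hnot
  exact hnot.trans_le (mul_le_mul_of_nonneg_left (hmono (show (⟨d, hdn⟩ : Fin n) ≤ i from hi))
    (Nat.cast_nonneg _))

/-- With one node per round the coordinate energies g_i sum to t ≤ m, because the rows of W are unit
vectors. Each of the first d coordinates contributes at most l = log(1 + m/λ₁). Beyond them log(1 +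
g_i/λ_i) ≤ g_i/λ_i ≤ g_i·dl/m, which sums to at most dl. The two halves give the factor 2. -/
theorem log_det_gram_le_effectiveDim (hlam : ∀ i, 0 < lam i) (hmono : Monotone lam)
    {W : Matrix (Fin n) (Fin n) ℝ} (hW : W * Wᵀ = 1) {S : ℕ → Finset (Fin n)}
    {k : ℕ → Fin n} (hS : ∀ t ∈ Finset.Icc 1 m, S t = {k t}) (hm : 1 ≤ m) {t : ℕ} (ht : t ≤ m) :
    Real.log (gram lam W S t).det - Real.log (diagonal lam).det ≤
      2 * (effectiveDim lam m * Real.log (1 + (m : ℝ) / lam 0)) := by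
  set d := effectiveDim lam m with hd
  set l := Real.log (1 + (m : ℝ) / lam 0) with hl
  have hl0 : 0 < l := log_one_add_div_pos hlam hm
  have hd0 : (0 : ℝ) < d := by exact_mod_cast one_le_effectiveDim hlam hm
  have hm0 : (0 : ℝ) < m := by exact_mod_cast hm
  set g : Fin n → ℝ := fun i => ∑ s ∈ Finset.Icc 1 t, ∑ j ∈ S s, W j i ^ 2 with hg
  have hg0 : ∀ i, 0 ≤ g i := fun i =>
    Finset.sum_nonneg fun s _ => Finset.sum_nonneg fun i _ => sq_nonneg _
  have hgsum : ∑ i, g i = t := by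
    simp only [hg]
    rw [Finset.sum_comm]
    calc ∑ s ∈ Finset.Icc 1 t, ∑ i, ∑ j ∈ S s, W j i ^ 2 = ∑ s ∈ Finset.Icc 1 t, (1 : ℝ) := by
          refine Finset.sum_congr rfl fun s hs => ?_
          rw [hS s (Finset.Icc_subset_Icc_right ht hs)]
          simp [sum_row_sq hW]
      _ = t := by simp
  have hgm : ∑ i, g i ≤ m := by rw [hgsum]; exact_mod_cast ht
  refine (log_det_gram_le hlam t).trans ?_
  have hbound : ∀ i : Fin n, Real.log (1 + g i / lam i) ≤
      (if i.val < d then l else 0) + g i * (d * l / m) := by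
    intro i
    have hgi := hg0 i
    have hli := hlam i
    split_ifs with h
    · have h1 : g i ≤ m := (Finset.single_le_sum (fun i _ => hg0 i) (Finset.mem_univ i)).trans hgm
      have h2 : Real.log (1 + g i / lam i) ≤ l := by
        refine Real.log_le_log (by positivity) ?_
        have h3 : lam 0 ≤ lam i := hmono (Fin.zero_le i)
        have h0 := hlam 0
        gcongr
      have : 0 ≤ g i * (d * l / m) := by positivity
      linarith
    · have h1 := lt_effectiveDim_mul hmono (not_lt.1 h)
      rw [← hd, ← hl, div_lt_iff₀ hl0] at h1
      have h2 : 1 / lam i ≤ d * l / m := by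
        rw [div_le_div_iff₀ hli hm0]
        nlinarith
      have h3 : Real.log (1 + g i / lam i) ≤ g i / lam i := by
        have := Real.log_le_sub_one_of_pos (show 0 < 1 + g i / lam i by positivity)
        linarith
      calc _ ≤ g i / lam i := h3
        _ = g i * (1 / lam i) := by ring
        _ ≤ g i * (d * l / m) := mul_le_mul_of_nonneg_left h2 hgi
        _ = _ := by ring
  refine (Finset.sum_le_sum fun i _ => hbound i).trans ?_
  rw [Finset.sum_add_distrib, ← Finset.sum_mul, ← Finset.sum_filter, Finset.sum_const, nsmul_eq_mul]
  have hcard : ((Finset.univ.filter fun i : Fin n => i.val < d).card : ℝ) ≤ d := by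
    have : (Finset.univ.filter fun i : Fin n => i.val < d).card ≤ (Finset.range d).card :=
      Finset.card_le_card_of_injOn (fun i => i.val) (fun i hi => by simpa using hi)
        fun a _ b _ hab => Fin.ext hab
    rw [Finset.card_range] at this
    exact_mod_cast this
  have h1 : (∑ i, g i) * (d * l / m) ≤ m * (d * l / m) :=
    mul_le_mul_of_nonneg_right hgm (by positivity)
  have h2 : (m : ℝ) * (d * l / m) = d * l := by field_simp
  nlinarith

end EffectiveDim

/-! ### Gaussian integrals -/

section Gaussian

variable {n : ℕ}

/-- The total mass of the unnormalized standard Gaussian density on `ℝⁿ`. -/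
def gaussianMass (n : ℕ) : ℝ≥0∞ :=
  ∫⁻ x : Fin n → ℝ, ENNReal.ofReal (Real.exp (-(x ⬝ᵥ x) / 2))

/-- The value of the mass is never needed: it is a common factor that cancels once it is known to be
finite and nonzero. -/
theorem gaussianMass_ne_top (n : ℕ) : gaussianMass n ≠ ⊤ := by
  have h1 : Integrable (fun x : ℝ => Real.exp (-(1 / 2) * x ^ 2)) :=
    integrable_exp_neg_mul_sq (by norm_num)
  have h2 : Integrable (fun x : Fin n → ℝ => ∏ i, Real.exp (-(1 / 2) * x i ^ 2)) :=
    Integrable.fintype_prod (f := fun _ => fun x : ℝ => Real.exp (-(1 / 2) * x ^ 2)) fun _ => h1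
  have h3 := h2.lintegral_lt_top
  refine ne_of_lt (lt_of_le_of_lt (le_of_eq ?_) h3)
  refine lintegral_congr fun x => ?_
  rw [← Real.exp_sum]
  congr 2
  rw [← Finset.mul_sum]
  simp only [dotProduct, sq]
  ring

theorem gaussianMass_ne_zero (n : ℕ) : gaussianMass n ≠ 0 := by
  intro h
  have hmeas : Measurable fun x : Fin n → ℝ => ENNReal.ofReal (Real.exp (-(x ⬝ᵥ x) / 2)) := by
    unfold dotProduct
    fun_prop
  rw [gaussianMass, lintegral_eq_zero_iff hmeas] at h
  have : ∀ᵐ x : Fin n → ℝ, False := by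
    filter_upwards [h] with x hx
    simp [not_le.2 (Real.exp_pos _)] at hx
  exact this.exists.elim fun _ h => h

theorem _root_.Matrix.PosDef.exists_transpose_mul_self {Q : Matrix (Fin n) (Fin n) ℝ}
    (hQ : Q.PosDef) : ∃ B : Matrix (Fin n) (Fin n) ℝ, Q = Bᵀ * B := by
  open scoped MatrixOrder in
  obtain ⟨B, hB⟩ := CStarAlgebra.nonneg_iff_eq_star_mul_self.mp hQ.posSemidef.nonneg
  exact ⟨B, by rw [hB, star_eq_conjTranspose, conjTranspose_eq_transpose_of_trivial]⟩

/-- The Gaussian integral with a linear term. -/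
theorem lintegral_exp_sub_quadratic {Q : Matrix (Fin n) (Fin n) ℝ} (hQ : Q.PosDef)
    (z : Fin n → ℝ) :
    ∫⁻ x : Fin n → ℝ, ENNReal.ofReal (Real.exp (x ⬝ᵥ z - x ⬝ᵥ (Q *ᵥ x) / 2)) =
      ENNReal.ofReal (Real.exp (z ⬝ᵥ (Q⁻¹ *ᵥ z) / 2) / Real.sqrt Q.det) * gaussianMass n := by
  -- After completing the square around Q⁻¹z, the substitution by B with Q = BᵀB reduces to the
  -- standard Gaussian, with Jacobian |det B| = √det Q.
  obtain ⟨B, hB⟩ := hQ.exists_transpose_mul_self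
  have hdet : Q.det = B.det ^ 2 := by rw [hB, det_mul, det_transpose, sq]
  have hB0 : B.det ≠ 0 := by
    intro h
    have := hQ.det_pos
    rw [hdet, h] at this
    simp at this
  have hu : IsUnit Q.det := (isUnit_iff_isUnit_det _).1 hQ.isUnit
  have hQz : Q *ᵥ (Q⁻¹ *ᵥ z) = z := by rw [mulVec_mulVec, mul_nonsing_inv _ hu, one_mulVec]
  have hBx : ∀ x : Fin n → ℝ, (B *ᵥ x) ⬝ᵥ (B *ᵥ x) = x ⬝ᵥ (Q *ᵥ x) := by
    intro x
    rw [hB, ← mulVec_mulVec, dotProduct_mulVec x, vecMul_transpose]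
  set u := Q⁻¹ *ᵥ z with hudef
  have hsq : ∀ x : Fin n → ℝ, x ⬝ᵥ z - x ⬝ᵥ (Q *ᵥ x) / 2 =
      z ⬝ᵥ u / 2 + -((B *ᵥ (x - u)) ⬝ᵥ (B *ᵥ (x - u))) / 2 := by
    intro x
    rw [hBx, mulVec_sub, dotProduct_sub, sub_dotProduct, sub_dotProduct,
      dotProduct_mulVec_comm hQ u x, hQz, dotProduct_comm z u]
    ring
  have hmeas : Measurable fun x : Fin n → ℝ => ENNReal.ofReal (Real.exp (-(x ⬝ᵥ x) / 2)) := by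
    unfold dotProduct
    fun_prop
  have hlin : Measurable (toLin' B) := (LinearMap.continuous_of_finiteDimensional _).measurable
  have hmap := lintegral_map (μ := (volume : Measure (Fin n → ℝ))) hmeas hlin
  rw [Real.map_matrix_volume_pi_eq_smul_volume_pi hB0, lintegral_smul_measure] at hmap
  simp only [toLin'_apply, smul_eq_mul] at hmap
  simp only [hsq, Real.exp_add, ENNReal.ofReal_mul (Real.exp_nonneg _)]
  rw [lintegral_const_mul' _ _ ENNReal.ofReal_ne_top,
    lintegral_sub_right_eq_self (μ := (volume : Measure (Fin n → ℝ)))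
      (fun x => ENNReal.ofReal (Real.exp (-((B *ᵥ x) ⬝ᵥ (B *ᵥ x)) / 2))) u, ← hmap,
    div_eq_mul_inv (Real.exp _), ENNReal.ofReal_mul (Real.exp_nonneg _), mul_assoc, hdet,
    Real.sqrt_sq_eq_abs, abs_inv, gaussianMass]

end Gaussian

/-! ### A maximal inequality for supermartingales -/

section Ville

variable {Ω : Type*} {mΩ : MeasurableSpace Ω} {μ : Measure Ω} {F : Filtration ℕ mΩ}
  {f : ℕ → Ω → ℝ≥0∞}

/-- **Ville's maximal inequality** for nonnegative supermartingales, over a finite horizon. -/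
theorem mul_measure_exists_le_le_lintegral {T : ℕ} (hf : ∀ t ≤ T, Measurable[F t] (f t))
    (hsup : ∀ t < T, ∀ A, MeasurableSet[F t] A → ∫⁻ ω in A, f (t + 1) ω ∂μ ≤ ∫⁻ ω in A, f t ω ∂μ)
    (ε : ℝ≥0∞) : ε * μ {ω | ∃ t ≤ T, ε ≤ f t ω} ≤ ∫⁻ ω, f 0 ω ∂μ := by
  set B : ℕ → Set Ω := fun T => {ω | ∃ t ≤ T, ε ≤ f t ω} with hB
  have hlev : ∀ t ≤ T, MeasurableSet[F t] {ω | ε ≤ f t ω} := fun t ht =>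
    measurableSet_le measurable_const (hf t ht)
  have hBsucc : ∀ t, B (t + 1) = B t ∪ {ω | ε ≤ f (t + 1) ω} := by
    intro t
    ext ω
    simp only [hB, Set.mem_union, Set.mem_ofPred_eq]
    constructor
    · rintro ⟨s, hs, h⟩
      rcases Nat.le_succ_iff.1 hs with hs | rfl
      · exact Or.inl ⟨s, hs, h⟩
      · exact Or.inr h
    · rintro (⟨s, hs, h⟩ | h)
      · exact ⟨s, hs.trans (Nat.le_succ t), h⟩
      · exact ⟨t + 1, le_rfl, h⟩
  have hBm : ∀ t ≤ T, MeasurableSet[F t] (B t) := by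
    intro t
    induction t with
    | zero =>
      intro ht
      have : B 0 = {ω | ε ≤ f 0 ω} := by ext ω; simp [hB]
      rw [this]
      exact hlev 0 ht
    | succ t ih =>
      intro ht
      rw [hBsucc]
      exact MeasurableSet.union (F.mono (Nat.le_succ t) _ (ih ((Nat.le_succ t).trans ht)))
        (hlev _ ht)
  have hlow : ∀ t ≤ T, ∀ A, MeasurableSet A →
      ε * μ (A ∩ {ω | ε ≤ f t ω}) + ∫⁻ ω in A \ {ω | ε ≤ f t ω}, f t ω ∂μ ≤
        ∫⁻ ω in A, f t ω ∂μ := by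
    intro t ht A hA
    have hm := F.le t _ (hlev t ht)
    rw [← lintegral_inter_add_sdiff (f t) A hm]
    gcongr
    rw [← setLIntegral_const]
    exact setLIntegral_mono' (hA.inter hm) fun ω hω => hω.2
  -- Keeping the integral of `f t` over the paths that have not yet crossed makes the claim
  -- inductive: the next crossing is paid for out of this remaining mass.
  suffices h : ∀ t ≤ T, ε * μ (B t) + ∫⁻ ω in (B t)ᶜ, f t ω ∂μ ≤ ∫⁻ ω, f 0 ω ∂μ from
    le_self_add.trans (h T le_rfl)
  intro t
  induction t with
  | zero =>
    intro ht
    have h := hlow 0 ht Set.univ MeasurableSet.univ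
    have : B 0 = {ω | ε ≤ f 0 ω} := by ext ω; simp [hB]
    rwa [Set.univ_inter, Measure.restrict_univ, ← Set.compl_eq_univ_sdiff, ← this] at h
  | succ t ih =>
    intro ht
    have htT := (Nat.le_succ t).trans ht
    have hBt := hBm t htT
    have hc := F.le t _ hBt.compl
    have h1 := hlow (t + 1) ht (B t)ᶜ hc
    have h2 := hsup t ht (B t)ᶜ hBt.compl
    have hle : μ (B (t + 1)) ≤ μ (B t) + μ ((B t)ᶜ ∩ {ω | ε ≤ f (t + 1) ω}) := by
      refine (measure_mono ?_).trans (measure_union_le _ _)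
      rw [hBsucc]
      intro ω hω
      by_cases h : ω ∈ B t
      · exact Or.inl h
      · exact Or.inr ⟨h, hω.resolve_left h⟩
    have hdiff : (B t)ᶜ \ {ω | ε ≤ f (t + 1) ω} = (B (t + 1))ᶜ := by
      rw [hBsucc, Set.compl_union, Set.sdiff_eq]
    rw [hdiff] at h1
    calc ε * μ (B (t + 1)) + ∫⁻ ω in (B (t + 1))ᶜ, f (t + 1) ω ∂μ
        ≤ ε * (μ (B t) + μ ((B t)ᶜ ∩ {ω | ε ≤ f (t + 1) ω})) +
          ∫⁻ ω in (B (t + 1))ᶜ, f (t + 1) ω ∂μ := by gcongr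
      _ = ε * μ (B t) + (ε * μ ((B t)ᶜ ∩ {ω | ε ≤ f (t + 1) ω}) +
          ∫⁻ ω in (B (t + 1))ᶜ, f (t + 1) ω ∂μ) := by rw [mul_add, add_assoc]
      _ ≤ ε * μ (B t) + ∫⁻ ω in (B t)ᶜ, f t ω ∂μ := by gcongr; exact h1.trans h2
      _ ≤ _ := ih htT

end Ville

/-! ### Conditional independence and the conditional Hoeffding lemma -/

section ConditionalHoeffding

/-- Independence of finitely many real random variables can be tested on rational lower orthants. -/
theorem iIndepFun_of_measure_Iic_rat {n : ℕ} {Ω : Type*} {mΩ : MeasurableSpace Ω} {ν : Measure Ω}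
    [IsProbabilityMeasure ν] {X : Fin n → Ω → ℝ} (hX : ∀ i, Measurable (X i))
    (h : ∀ q : Fin n → ℚ, ν (⋂ i, X i ⁻¹' Set.Iic (q i : ℝ)) =
      ∏ i, ν (X i ⁻¹' Set.Iic (q i : ℝ))) : iIndepFun X ν := by
  rw [iIndepFun_iff_map_fun_eq_pi_map fun i => (hX i).aemeasurable]
  symm
  have hp : ∀ i, IsProbabilityMeasure (ν.map (X i)) := fun i =>
    Measure.isProbabilityMeasure_map (hX i).aemeasurable
  refine Measure.pi_eq_generateFrom (C := fun _ => ⋃ a : ℚ, {Set.Iic (a : ℝ)})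
    (fun _ => Real.borel_eq_generateFrom_Iic_rat.symm.trans (BorelSpace.measurable_eq).symm)
    (fun _ => Real.isPiSystem_Iic_rat)
    (fun i => ⟨fun k => Set.Iic (k : ℝ), fun k => ?_, fun k => measure_lt_top _ _, ?_⟩) ?_
  · exact Set.mem_iUnion.2 ⟨(k : ℚ), by simp⟩
  · refine Set.eq_univ_of_forall fun x => Set.mem_iUnion.2 ?_
    exact exists_nat_ge x
  · intro s hs
    have hs' : ∀ i, ∃ q : ℚ, s i = Set.Iic (q : ℝ) := fun i => by simpa [eq_comm] using hs i
    choose q hq using hs'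
    rw [Measure.map_apply (measurable_pi_lambda _ hX)
      (MeasurableSet.univ_pi fun i => by rw [hq]; exact measurableSet_Iic)]
    have e : (fun ω i => X i ω) ⁻¹' Set.univ.pi s = ⋂ i, X i ⁻¹' Set.Iic (q i : ℝ) := by
      ext ω
      simp [hq]
    rw [e, h]
    refine Finset.prod_congr rfl fun i _ => ?_
    rw [hq, Measure.map_apply (hX i) measurableSet_Iic]

/-- Hoeffding's lemma for each coordinate; by independence the variance proxies a_i²(hi_i - lo_i)²/4
add up. -/
theorem hasSubgaussianMGF_sum_mul {n : ℕ} {Ω : Type*} {mΩ : MeasurableSpace Ω} {ν : Measure Ω}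
    [IsProbabilityMeasure ν] {X : Fin n → Ω → ℝ} (hX : ∀ i, Measurable (X i))
    (hind : iIndepFun X ν) (hmean : ∀ i, ∫ ω, X i ω ∂ν = 0) {lo hi : Fin n → ℝ} {Δ : ℝ}
    (hrange : ∀ᵐ ω ∂ν, ∀ i, lo i ≤ X i ω ∧ X i ω ≤ hi i) (hwidth : ∀ i, hi i - lo i ≤ Δ)
    (a : Fin n → ℝ) :
    ∫⁻ ω, ENNReal.ofReal (Real.exp (∑ i, a i * X i ω)) ∂ν ≤
      ENNReal.ofReal (Real.exp (Δ ^ 2 / 8 * ∑ i, a i ^ 2)) := by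
  have hle : ∀ i, lo i ≤ hi i := by
    intro i
    obtain ⟨ω, hω⟩ := hrange.exists
    exact (hω i).1.trans (hω i).2
  have hsubi : ∀ i, HasSubgaussianMGF (fun ω => a i * X i ω)
      (Real.toNNReal (a i ^ 2 * ((hi i - lo i) / 2) ^ 2)) ν := by
    intro i
    have h := (hasSubgaussianMGF_of_mem_Icc_of_integral_eq_zero (hX i).aemeasurable
      (hrange.mono fun ω hω => ⟨(hω i).1, (hω i).2⟩) (hmean i)).const_mul (a i)
    convert h using 1
    apply NNReal.eq
    rw [Real.coe_toNNReal _ (by positivity)]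
    refine Eq.trans ?_ (NNReal.coe_mul _ _).symm
    simp only [div_pow, NNReal.coe_pow, NNReal.coe_div, coe_nnnorm, Real.norm_eq_abs, sq_abs,
      NNReal.coe_ofNat]
    rfl
  have hsub := HasSubgaussianMGF.sum_of_iIndepFun (s := Finset.univ)
    (hind.comp (fun i x => a i * x) fun i => measurable_const_mul (a i)) fun i _ => hsubi i
  have hint := hsub.integrable_exp_mul 1
  have hmgf := hsub.mgf_le 1
  simp only [one_mul, Function.comp_apply, mgf] at hint hmgf
  rw [← ofReal_integral_eq_lintegral_ofReal hint (ae_of_all _ fun ω => Real.exp_nonneg _)]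
  refine ENNReal.ofReal_le_ofReal (hmgf.trans (Real.exp_le_exp.2 ?_))
  simp only [NNReal.coe_sum, Finset.mul_sum, Finset.sum_mul, Finset.sum_div]
  refine Finset.sum_le_sum fun i _ => ?_
  have h1 : (hi i - lo i) ^ 2 ≤ Δ ^ 2 :=
    pow_le_pow_left₀ (sub_nonneg.2 (hle i)) (hwidth i) 2
  have h2 := mul_le_mul_of_nonneg_right h1 (sq_nonneg (a i))
  rw [Real.coe_toNNReal _ (by positivity)]
  linarith

variable {n : ℕ} {Ω : Type*} {m : MeasurableSpace Ω} [mΩ : MeasurableSpace Ω]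
  [StandardBorelSpace Ω] {μ : Measure Ω} [IsFiniteMeasure μ]

/-- Drawing ω from the trimmed measure and then ω' from the kernel at ω gives the image of μ on the
diagonal. Hence `m`-measurable data, such as predictable ranges, can be frozen at ω while the noise
is integrated over ω'. -/
theorem ae_ae_condExpKernel (hm : m ≤ mΩ) {p : Ω → Ω → Prop}
    (hp : MeasurableSet[m.prod mΩ] {x : Ω × Ω | p x.1 x.2}) (h : ∀ᵐ ω ∂μ, p ω ω) :
    ∀ᵐ ω ∂(μ.trim hm), ∀ᵐ ω' ∂(condExpKernel μ m ω), p ω ω' := by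
  have hdiag : @Measurable Ω (Ω × Ω) mΩ (m.prod mΩ) Function.diag :=
    (measurable_id'' hm).prodMk measurable_id
  refine Measure.ae_ae_of_ae_compProd (p := fun x : Ω × Ω => p x.1 x.2) ?_
  rw [compProd_trim_condExpKernel]
  exact (@ae_map_iff Ω (Ω × Ω) mΩ (m.prod mΩ) μ _
    (@Measurable.aemeasurable Ω (Ω × Ω) mΩ (m.prod mΩ) _ μ hdiag) _ hp).2 h

theorem lintegral_mul_eq_lintegral_condExpKernel (hm : m ≤ mΩ) {g f : Ω → ℝ≥0∞}
    (hg : Measurable[m] g) (hf : Measurable f) :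
    ∫⁻ ω, g ω * f ω ∂μ = ∫⁻ ω, g ω * ∫⁻ ω', f ω' ∂(condExpKernel μ m ω) ∂(μ.trim hm) := by
  have hdiag : @Measurable Ω (Ω × Ω) mΩ (m.prod mΩ) Function.diag :=
    (measurable_id'' hm).prodMk measurable_id
  have hgf : @Measurable (Ω × Ω) ℝ≥0∞ (m.prod mΩ) _ fun x => g x.1 * f x.2 :=
    (hg.comp (@measurable_fst Ω Ω m mΩ)).mul (hf.comp (@measurable_snd Ω Ω m mΩ))
  have h1 := @lintegral_map Ω (Ω × Ω) mΩ (m.prod mΩ) μ _ _ hgf hdiag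
  rw [← compProd_trim_condExpKernel hm, Measure.lintegral_compProd hgf] at h1
  refine h1.symm.trans (lintegral_congr fun ω => ?_)
  exact lintegral_const_mul (g ω) hf

theorem ae_iIndepFun_condExpKernel {hm : m ≤ mΩ} {X : Fin n → Ω → ℝ} (hX : ∀ i, Measurable (X i))
    (hind : iCondIndepFun m hm X μ) :
    ∀ᵐ ω ∂(μ.trim hm), iIndepFun X (condExpKernel μ m ω) := by
  -- Conditional independence gives a null set for each family of sets; restricting to the countably
  -- many rational orthants leaves a single null set.
  have h : ∀ᵐ ω ∂(μ.trim hm), ∀ q : Fin n → ℚ,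
      condExpKernel μ m ω (⋂ i, X i ⁻¹' Set.Iic (q i : ℝ)) =
        ∏ i, condExpKernel μ m ω (X i ⁻¹' Set.Iic (q i : ℝ)) := by
    rw [ae_all_iff]
    intro q
    have := ((Kernel.iIndepFun_iff_measure_inter_preimage_eq_mul _ _).1 hind) Finset.univ
      (sets := fun i => Set.Iic (q i : ℝ)) fun i _ => measurableSet_Iic
    simpa using this
  exact h.mono fun ω hω => iIndepFun_of_measure_Iic_rat hX hω

/-- The **conditional Hoeffding lemma** for conditionally independent, conditionally centred random
variables with predictable ranges. -/
theorem lintegral_mul_exp_le {hm : m ≤ mΩ} {X : Fin n → Ω → ℝ} (hX : ∀ i, Measurable (X i))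
    (hint : ∀ i, Integrable (X i) μ) (hmean : ∀ i, μ[X i | m] =ᵐ[μ] 0)
    (hind : iCondIndepFun m hm X μ) {lo hi : Ω → Fin n → ℝ}
    (hlo : ∀ i, Measurable[m] fun ω => lo ω i) (hhi : ∀ i, Measurable[m] fun ω => hi ω i) {Δ : ℝ}
    (hrange : ∀ᵐ ω ∂μ, ∀ i, lo ω i ≤ X i ω ∧ X i ω ≤ hi ω i)
    (hwidth : ∀ᵐ ω ∂μ, ∀ i, hi ω i - lo ω i ≤ Δ) (a : Fin n → ℝ) {g : Ω → ℝ≥0∞}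
    (hg : Measurable[m] g) :
    ∫⁻ ω, g ω * ENNReal.ofReal (Real.exp (∑ i, a i * X i ω)) ∂μ ≤
      ENNReal.ofReal (Real.exp (Δ ^ 2 / 8 * ∑ i, a i ^ 2)) * ∫⁻ ω, g ω ∂μ := by
  have hf : Measurable fun ω => ENNReal.ofReal (Real.exp (∑ i, a i * X i ω)) := by fun_prop
  have h1 : ∀ᵐ ω ∂(μ.trim hm), ∀ᵐ ω' ∂(condExpKernel μ m ω),
      ∀ i, (lo ω i ≤ X i ω' ∧ X i ω' ≤ hi ω i) ∧ hi ω i - lo ω i ≤ Δ := by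
    refine ae_ae_condExpKernel hm ?_ ?_
    · have : {x : Ω × Ω | ∀ i, (lo x.1 i ≤ X i x.2 ∧ X i x.2 ≤ hi x.1 i) ∧ hi x.1 i - lo x.1 i ≤ Δ}
          = ⋂ i, (({x : Ω × Ω | lo x.1 i ≤ X i x.2} ∩ {x | X i x.2 ≤ hi x.1 i}) ∩
            {x | hi x.1 i - lo x.1 i ≤ Δ}) := by
        ext x; simp
      rw [this]
      have hl : ∀ i, @Measurable (Ω × Ω) ℝ (m.prod mΩ) _ fun x => lo x.1 i := fun i =>
        (hlo i).comp (@measurable_fst Ω Ω m mΩ)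
      have hh : ∀ i, @Measurable (Ω × Ω) ℝ (m.prod mΩ) _ fun x => hi x.1 i := fun i =>
        (hhi i).comp (@measurable_fst Ω Ω m mΩ)
      have hx : ∀ i, @Measurable (Ω × Ω) ℝ (m.prod mΩ) _ fun x => X i x.2 := fun i =>
        (hX i).comp (@measurable_snd Ω Ω m mΩ)
      exact MeasurableSet.iInter fun i => ((measurableSet_le (hl i) (hx i)).inter
        (measurableSet_le (hx i) (hh i))).inter
          (measurableSet_le ((hh i).sub (hl i)) measurable_const)
    · filter_upwards [hrange, hwidth] with ω h1 h2 i using ⟨h1 i, h2 i⟩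
  have h2 : ∀ᵐ ω ∂(μ.trim hm), ∀ i, ∫ ω', X i ω' ∂(condExpKernel μ m ω) = 0 := by
    rw [ae_all_iff]
    intro i
    have h3 := condExp_ae_eq_trim_integral_condExpKernel hm (hint i)
    have h4 : μ[X i | m] =ᵐ[μ.trim hm] 0 :=
      StronglyMeasurable.ae_eq_trim_of_stronglyMeasurable hm stronglyMeasurable_condExp
        stronglyMeasurable_zero (hmean i)
    filter_upwards [h3, h4] with ω h5 h6
    rw [← h5, h6, Pi.zero_apply]
  rw [lintegral_mul_eq_lintegral_condExpKernel hm hg hf, ← lintegral_trim hm hg, mul_comm,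
    ← lintegral_mul_const _ hg]
  refine lintegral_mono_ae ?_
  filter_upwards [h1, h2, ae_iIndepFun_condExpKernel hX hind] with ω h1 h2 h3
  -- The width bound does not depend on ω', so any one point of the kernel's full-measure set
  -- supplies it.
  obtain ⟨ω₀, hω₀⟩ := h1.exists
  gcongr
  exact hasSubgaussianMGF_sum_mul hX h3 h2 (h1.mono fun ω' h i => (h i).1) (fun i => (hω₀ i).2) a

end ConditionalHoeffding

/-! ### Noise and bias of the least-squares estimate -/

section ScoreSum

variable {n : ℕ}

/-- The noise component `∑_{s=1}^t ∑_{i ∈ S_s} η_{s,i} w_i` of the least-squares score. -/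
def scoreSum (W : Matrix (Fin n) (Fin n) ℝ) (S : ℕ → Finset (Fin n)) (η : ℕ → Fin n → ℝ) (t : ℕ) :
    Fin n → ℝ :=
  ∑ s ∈ Finset.Icc 1 t, ∑ i ∈ S s, η s i • W i

variable {lam : Fin n → ℝ} {W : Matrix (Fin n) (Fin n) ℝ} {S : ℕ → Finset (Fin n)}

theorem scoreSum_zero (η : ℕ → Fin n → ℝ) : scoreSum W S η 0 = 0 := by simp [scoreSum]

theorem scoreSum_succ (η : ℕ → Fin n → ℝ) (t : ℕ) :
    scoreSum W S η (t + 1) = scoreSum W S η t + ∑ i ∈ S (t + 1), η (t + 1) i • W i := by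
  rw [scoreSum, scoreSum, Finset.sum_Icc_succ_top (Nat.succ_le_succ (Nat.zero_le t))]

theorem scoreSum_smul (c : ℝ) (η : ℕ → Fin n → ℝ) (t : ℕ) :
    scoreSum W S (fun s => c • η s) t = c • scoreSum W S η t := by
  simp only [scoreSum, Finset.smul_sum, Pi.smul_apply, smul_smul, smul_eq_mul]

theorem gram_mulVec (t : ℕ) (ψ : Fin n → ℝ) :
    gram lam W S t *ᵥ ψ = diagonal lam *ᵥ ψ + scoreSum W S (fun _ i => W i ⬝ᵥ ψ) t := by
  simp only [gram, scoreSum, add_mulVec, sum_mulVec, vecMulVec_mulVec]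
  simp

/-- The error splits into the noise score and the bias -Λψ of the regularizer, both multiplied by
V⁻¹. -/
theorem estimate_sub (hlam : ∀ i, 0 < lam i) {y η : ℕ → Fin n → ℝ} {ψ : Fin n → ℝ} {t : ℕ}
    (hy : ∀ s ∈ Finset.Icc 1 (t - 1), ∀ i ∈ S s, y s i = W i ⬝ᵥ ψ + η s i) :
    estimate lam W S y t - ψ =
      (gram lam W S (t - 1))⁻¹ *ᵥ (scoreSum W S η (t - 1) - diagonal lam *ᵥ ψ) := by
  have hu : IsUnit (gram lam W S (t - 1)).det :=
    (isUnit_iff_isUnit_det _).1 (posDef_gram hlam _).isUnit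
  have h1 : ∑ s ∈ Finset.Icc 1 (t - 1), ∑ i ∈ S s, y s i • W i =
      gram lam W S (t - 1) *ᵥ ψ + (scoreSum W S η (t - 1) - diagonal lam *ᵥ ψ) := by
    rw [gram_mulVec, add_assoc, add_comm (scoreSum W S _ _), sub_add_eq_add_sub, ← add_sub_assoc,
      add_sub_cancel_left, scoreSum, scoreSum, ← Finset.sum_add_distrib]
    refine Finset.sum_congr rfl fun s hs => ?_
    rw [← Finset.sum_add_distrib]
    refine Finset.sum_congr rfl fun i hi => ?_
    rw [hy s hs i hi, add_smul, add_comm]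
  rw [estimate, h1, mulVec_add, mulVec_mulVec, nonsing_inv_mul _ hu, one_mulVec,
    add_sub_cancel_left]

/-- Cauchy–Schwarz for V⁻¹; since V dominates Λ, the bias Λψ has V⁻¹-norm at most ‖ψ‖_Λ. -/
theorem abs_dotProduct_estimate_sub_le (hlam : ∀ i, 0 < lam i) {y η : ℕ → Fin n → ℝ}
    {ψ : Fin n → ℝ} {t : ℕ} (hy : ∀ s ∈ Finset.Icc 1 (t - 1), ∀ i ∈ S s, y s i = W i ⬝ᵥ ψ + η s i)
    (w : Fin n → ℝ) :
    |w ⬝ᵥ (estimate lam W S y t - ψ)| ≤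
      (matNorm (gram lam W S (t - 1))⁻¹ (scoreSum W S η (t - 1)) + matNorm (diagonal lam) ψ) *
        matNorm (gram lam W S (t - 1))⁻¹ w := by
  have hV := posDef_gram (W := W) (S := S) hlam (t - 1)
  rw [estimate_sub hlam hy, mul_comm]
  refine (abs_dotProduct_mulVec_le hV.inv _ _).trans ?_
  refine mul_le_mul_of_nonneg_left ((matNorm_sub_le hV.inv _ _).trans ?_) (matNorm_nonneg _ _)
  gcongr
  exact matNorm_inv_mulVec_le (PosDef.diagonal hlam) hV (dotProduct_diagonal_le_gram _) ψ

end ScoreSum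

/-! ### The method of mixtures -/

section Mixture

variable {n : ℕ} {Ω : Type*}

/-- The exponential process `exp (⟨x, z⟩ - xᵀ V x / 2)` of the method of mixtures. -/
def expQuadratic (V : Matrix (Fin n) (Fin n) ℝ) (z x : Fin n → ℝ) : ℝ≥0∞ :=
  ENNReal.ofReal (Real.exp (x ⬝ᵥ z - x ⬝ᵥ (V *ᵥ x) / 2))

theorem measurable_expQuadratic {m : MeasurableSpace Ω} {V : Ω → Matrix (Fin n) (Fin n) ℝ}
    {z : Ω → Fin n → ℝ} (hV : ∀ i j, Measurable fun ω => V ω i j)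
    (hz : ∀ i, Measurable fun ω => z ω i) :
    Measurable fun p : (Fin n → ℝ) × Ω => expQuadratic (V p.2) (z p.2) p.1 := by
  have hV' : ∀ i j, Measurable fun p : (Fin n → ℝ) × Ω => V p.2 i j := fun i j =>
    (hV i j).comp measurable_snd
  have hz' : ∀ i, Measurable fun p : (Fin n → ℝ) × Ω => z p.2 i := fun i =>
    (hz i).comp measurable_snd
  unfold expQuadratic dotProduct mulVec dotProduct
  fun_prop

theorem measurable_expQuadratic_swap {m : MeasurableSpace Ω} {V : Ω → Matrix (Fin n) (Fin n) ℝ}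
    {z : Ω → Fin n → ℝ} (hV : ∀ i j, Measurable fun ω => V ω i j)
    (hz : ∀ i, Measurable fun ω => z ω i) :
    Measurable fun p : Ω × (Fin n → ℝ) => expQuadratic (V p.1) (z p.1) p.2 := by
  have h := (measurable_expQuadratic hV hz).comp (measurable_swap (α := Ω) (β := Fin n → ℝ))
  exact h

theorem measurable_expQuadratic_left {m : MeasurableSpace Ω} {V : Ω → Matrix (Fin n) (Fin n) ℝ}
    {z : Ω → Fin n → ℝ} (hV : ∀ i j, Measurable fun ω => V ω i j)
    (hz : ∀ i, Measurable fun ω => z ω i) (x : Fin n → ℝ) :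
    Measurable fun ω => expQuadratic (V ω) (z ω) x := by
  have h := (measurable_expQuadratic hV hz).comp (measurable_prodMk_left (x := x))
  exact h

theorem measurable_lintegral_expQuadratic {m : MeasurableSpace Ω}
    {V : Ω → Matrix (Fin n) (Fin n) ℝ} {z : Ω → Fin n → ℝ}
    (hV : ∀ i j, Measurable fun ω => V ω i j) (hz : ∀ i, Measurable fun ω => z ω i) :
    Measurable fun ω => ∫⁻ x, expQuadratic (V ω) (z ω) x :=
  (measurable_expQuadratic hV hz).lintegral_prod_left'

theorem expQuadratic_add_sum (V : Matrix (Fin n) (Fin n) ℝ) (z x : Fin n → ℝ)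
    (W : Matrix (Fin n) (Fin n) ℝ) (A : Finset (Fin n)) (η : Fin n → ℝ) :
    expQuadratic (V + ∑ i ∈ A, vecMulVec (W i) (W i)) (z + ∑ i ∈ A, η i • W i) x =
      ENNReal.ofReal (Real.exp (-((∑ i ∈ A, (W i ⬝ᵥ x) ^ 2) / 2))) * (expQuadratic V z x *
        ENNReal.ofReal (Real.exp (∑ i ∈ A, (W i ⬝ᵥ x) * η i))) := by
  have e1 : x ⬝ᵥ (∑ i ∈ A, η i • W i) = ∑ i ∈ A, (W i ⬝ᵥ x) * η i := by
    rw [dotProduct_sum]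
    exact Finset.sum_congr rfl fun i _ => by
      rw [dotProduct_smul, smul_eq_mul, dotProduct_comm, mul_comm]
  have e2 : x ⬝ᵥ ((∑ i ∈ A, vecMulVec (W i) (W i)) *ᵥ x) = ∑ i ∈ A, (W i ⬝ᵥ x) ^ 2 := by
    rw [sum_mulVec, dotProduct_sum]
    exact Finset.sum_congr rfl fun i _ => by
      rw [vecMulVec_mulVec]
      simp [dotProduct_comm x, sq]
  unfold expQuadratic
  rw [← ENNReal.ofReal_mul (Real.exp_nonneg _), ← ENNReal.ofReal_mul (Real.exp_nonneg _),
    ← Real.exp_add, ← Real.exp_add, add_mulVec, dotProduct_add, dotProduct_add, e1, e2]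
  congr 2
  ring

/-- A selection takes finitely many values, so a random index set can be replaced by a fixed one on
each piece of a finite partition. -/
theorem sum_indicator_eq (T : Ω → Finset (Fin n)) {α : Type*} [AddCommMonoid α]
    (h : Finset (Fin n) → Ω → α) (ω : Ω) :
    ∑ A, {ω | T ω = A}.indicator (h A) ω = h (T ω) ω := by
  rw [Finset.sum_eq_single (T ω)]
  · rw [Set.indicator_of_mem (f := h (T ω)) (show ω ∈ {ω' | T ω' = T ω} from rfl)]
  · intro A _ hA
    have hmem : ω ∉ {ω | T ω = A} := fun hm => hA (Eq.symm hm)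
    exact Set.indicator_of_notMem hmem (h A)
  · intro h
    exact absurd (Finset.mem_univ _) h

variable [mΩ : MeasurableSpace Ω]

/-- Selections `S` and noise `η` such that `S t` is known before round `t`, the noise at the selected
nodes is known after it, and the noise is conditionally sub-Gaussian with variance proxy `1`. -/
structure IsSubgaussianNoise (μ : Measure Ω) (F : Filtration ℕ mΩ) (m : ℕ)
    (S : ℕ → Ω → Finset (Fin n)) (η : ℕ → Ω → Fin n → ℝ) : Prop where
  selection : ∀ t < m, ∀ A, MeasurableSet[F t] {ω | S (t + 1) ω = A}
  noise : ∀ t < m, ∀ A : Finset (Fin n), ∀ i ∈ A,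
    Measurable[F (t + 1)] ({ω | S (t + 1) ω = A}.indicator fun ω => η (t + 1) ω i)
  measurable : ∀ t < m, ∀ i, Measurable fun ω => η (t + 1) ω i
  subgaussian : ∀ t < m, ∀ (A : Finset (Fin n)) (x : Fin n → ℝ) (g : Ω → ℝ≥0∞), Measurable[F t] g →
    ∫⁻ ω, g ω * ENNReal.ofReal (Real.exp (∑ i ∈ A, x i * η (t + 1) ω i)) ∂μ ≤
      ENNReal.ofReal (Real.exp ((∑ i ∈ A, x i ^ 2) / 2)) * ∫⁻ ω, g ω ∂μ

namespace IsSubgaussianNoise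

variable {μ : Measure Ω} {F : Filtration ℕ mΩ} {m : ℕ} {S : ℕ → Ω → Finset (Fin n)}
  {η : ℕ → Ω → Fin n → ℝ} {lam : Fin n → ℝ} {W : Matrix (Fin n) (Fin n) ℝ}

theorem measurable_gram (h : IsSubgaussianNoise μ F m S η) {t : ℕ} (ht : t ≤ m) (i j : Fin n) :
    Measurable[F t] fun ω => gram lam W (fun s => S s ω) t i j := by
  induction t with
  | zero => simp only [gram_zero]; exact measurable_const
  | succ t ih =>
    have h1 := (ih (Nat.le_of_succ_le ht)).mono (F.mono (Nat.le_succ t)) le_rfl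
    have h2 : ∀ ω, (∑ k ∈ S (t + 1) ω, vecMulVec (W k) (W k)) i j =
        ∑ A, {ω | S (t + 1) ω = A}.indicator
          (fun _ => (∑ k ∈ A, vecMulVec (W k) (W k)) i j) ω := fun ω =>
      (sum_indicator_eq (S (t + 1)) (fun A _ => (∑ k ∈ A, vecMulVec (W k) (W k)) i j) ω).symm
    simp only [gram_succ, Matrix.add_apply, h2]
    exact h1.add (Finset.measurable_fun_sum _ fun A _ =>
      measurable_const.indicator (F.mono (Nat.le_succ t) _ (h.selection t ht A)))

theorem measurable_scoreSum (h : IsSubgaussianNoise μ F m S η) {t : ℕ} (ht : t ≤ m) (j : Fin n) :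
    Measurable[F t] fun ω => scoreSum W (fun s => S s ω) (fun s => η s ω) t j := by
  induction t with
  | zero => simp only [scoreSum_zero]; exact measurable_const
  | succ t ih =>
    have h1 := (ih (Nat.le_of_succ_le ht)).mono (F.mono (Nat.le_succ t)) le_rfl
    have h2 : ∀ ω, (∑ k ∈ S (t + 1) ω, η (t + 1) ω k • W k) j =
        ∑ A, ∑ k ∈ A, {ω | S (t + 1) ω = A}.indicator (fun ω => η (t + 1) ω k) ω * W k j := by
      intro ω
      rw [← sum_indicator_eq (S (t + 1)) (fun A ω => (∑ k ∈ A, η (t + 1) ω k • W k) j) ω]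
      refine Finset.sum_congr rfl fun A _ => ?_
      by_cases hA : ω ∈ {ω | S (t + 1) ω = A}
      · simp [Set.indicator_of_mem hA, Finset.sum_apply]
      · simp [Set.indicator_of_notMem hA]
    simp only [scoreSum_succ, Pi.add_apply, h2]
    exact h1.add (Finset.measurable_fun_sum _ fun A _ => Finset.measurable_fun_sum _ fun k hk =>
      (h.noise t ht A k hk).mul_const _)

/-- The supermartingale property for fixed x. On each piece where the next selection is B, the
sub-Gaussian bound, tested against the current process restricted to that piece, produces a factor
that the quadratic term of the exponent cancels exactly. -/
theorem setLIntegral_expQuadratic_le (h : IsSubgaussianNoise μ F m S η) {t : ℕ} (ht : t < m)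
    {A : Set Ω} (hA : MeasurableSet[F t] A) (x : Fin n → ℝ) :
    ∫⁻ ω in A, expQuadratic (gram lam W (fun s => S s ω) (t + 1))
        (scoreSum W (fun s => S s ω) (fun s => η s ω) (t + 1)) x ∂μ ≤
      ∫⁻ ω in A, expQuadratic (gram lam W (fun s => S s ω) t)
        (scoreSum W (fun s => S s ω) (fun s => η s ω) t) x ∂μ := by
  have hMm : Measurable[F t] fun ω => expQuadratic (gram lam W (fun s => S s ω) t)
      (scoreSum W (fun s => S s ω) (fun s => η s ω) t) x :=
    measurable_expQuadratic_left (m := F t) (V := fun ω => gram lam W (fun s => S s ω) t)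
      (z := fun ω => scoreSum W (fun s => S s ω) (fun s => η s ω) t)
      (h.measurable_gram ht.le) (h.measurable_scoreSum ht.le) x
  simp only [gram_succ, scoreSum_succ, expQuadratic_add_sum]
  obtain ⟨M, hMω⟩ : ∃ M : Ω → ℝ≥0∞, ∀ ω, expQuadratic (gram lam W (fun s => S s ω) t)
      (scoreSum W (fun s => S s ω) (fun s => η s ω) t) x = M ω := ⟨_, fun _ => rfl⟩
  simp only [hMω] at hMm ⊢
  set c : Finset (Fin n) → ℝ := fun B => (∑ i ∈ B, (W i ⬝ᵥ x) ^ 2) / 2 with hc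
  set e : Finset (Fin n) → Ω → ℝ≥0∞ := fun B ω =>
    ENNReal.ofReal (Real.exp (∑ i ∈ B, (W i ⬝ᵥ x) * η (t + 1) ω i)) with he
  have hem : ∀ B, Measurable (e B) := fun B =>
    (Real.measurable_exp.comp (Finset.measurable_fun_sum _ fun i _ =>
      (h.measurable t ht i).const_mul _)).ennreal_ofReal
  have hM : Measurable M := hMm.mono (F.le t) le_rfl
  have hA' := F.le t _ hA
  have hE : ∀ B, MeasurableSet {ω | S (t + 1) ω = B} := fun B => F.le t _ (h.selection t ht B)
  calc ∫⁻ ω in A, ENNReal.ofReal (Real.exp (-c (S (t + 1) ω))) * (M ω * e (S (t + 1) ω) ω) ∂μ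
      = ∫⁻ ω in A, ∑ B, {ω | S (t + 1) ω = B}.indicator
          (fun ω => ENNReal.ofReal (Real.exp (-c B)) * (M ω * e B ω)) ω ∂μ :=
        lintegral_congr fun ω => (sum_indicator_eq (S (t + 1))
          (fun B ω => ENNReal.ofReal (Real.exp (-c B)) * (M ω * e B ω)) ω).symm
    _ = ∑ B, ∫⁻ ω in A, {ω | S (t + 1) ω = B}.indicator
          (fun ω => ENNReal.ofReal (Real.exp (-c B)) * (M ω * e B ω)) ω ∂μ :=
        lintegral_finsetSum _ fun B _ => ((hM.mul (hem B)).const_mul _).indicator (hE B)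
    _ ≤ ∑ B, ∫⁻ ω in A, {ω | S (t + 1) ω = B}.indicator M ω ∂μ := by
        refine Finset.sum_le_sum fun B _ => ?_
        set E := {ω | S (t + 1) ω = B} with hEdef
        have h1 := h.subgaussian t ht B (fun i => W i ⬝ᵥ x) ((E ∩ A).indicator M)
          (hMm.indicator ((h.selection t ht B).inter hA))
        have h2 : ∀ f : Ω → ℝ≥0∞, ∫⁻ ω in A, E.indicator f ω ∂μ =
            ∫⁻ ω, (E ∩ A).indicator f ω ∂μ := fun f => by
          rw [lintegral_indicator (hE B), Measure.restrict_restrict (hE B),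
            lintegral_indicator ((hE B).inter hA')]
        rw [h2, h2]
        have h3 : ∀ ω, (E ∩ A).indicator
            (fun ω => ENNReal.ofReal (Real.exp (-c B)) * (M ω * e B ω)) ω =
              ENNReal.ofReal (Real.exp (-c B)) * ((E ∩ A).indicator M ω * e B ω) := by
          intro ω
          by_cases hω : ω ∈ E ∩ A
          · simp only [Set.indicator_of_mem hω]
          · simp only [Set.indicator_of_notMem hω, zero_mul, mul_zero]
        simp only [h3]
        rw [lintegral_const_mul' _ _ ENNReal.ofReal_ne_top]
        refine (mul_le_mul_right h1 _).trans ?_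
        rw [← mul_assoc, ← ENNReal.ofReal_mul (Real.exp_nonneg _), ← Real.exp_add, neg_add_cancel,
          Real.exp_zero, ENNReal.ofReal_one, one_mul]
    _ = ∫⁻ ω in A, ∑ B, {ω | S (t + 1) ω = B}.indicator M ω ∂μ :=
        (lintegral_finsetSum _ fun B _ => hM.indicator (hE B)).symm
    _ = ∫⁻ ω in A, M ω ∂μ :=
        lintegral_congr fun ω => sum_indicator_eq (S (t + 1)) (fun _ => M) ω

theorem measurable_lintegral_expQuadratic (h : IsSubgaussianNoise μ F m S η) {t : ℕ} (ht : t ≤ m) :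
    Measurable[F t] fun ω => ∫⁻ x, expQuadratic (gram lam W (fun s => S s ω) t)
      (scoreSum W (fun s => S s ω) (fun s => η s ω) t) x :=
  SpectralSampling.measurable_lintegral_expQuadratic (m := F t)
      (V := fun ω => gram lam W (fun s => S s ω) t)
      (z := fun ω => scoreSum W (fun s => S s ω) (fun s => η s ω) t)
      (h.measurable_gram ht) (h.measurable_scoreSum ht)

/-- Tonelli's theorem passes the supermartingale property from each x to the mixture. -/
theorem setLIntegral_lintegral_expQuadratic_le [SFinite μ] (h : IsSubgaussianNoise μ F m S η)
    {t : ℕ} (ht : t < m) {A : Set Ω} (hA : MeasurableSet[F t] A) :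
    ∫⁻ ω in A, (∫⁻ x, expQuadratic (gram lam W (fun s => S s ω) (t + 1))
        (scoreSum W (fun s => S s ω) (fun s => η s ω) (t + 1)) x) ∂μ ≤
      ∫⁻ ω in A, (∫⁻ x, expQuadratic (gram lam W (fun s => S s ω) t)
        (scoreSum W (fun s => S s ω) (fun s => η s ω) t) x) ∂μ := by
  have hjoint : ∀ t ≤ m, Measurable fun p : Ω × (Fin n → ℝ) =>
      expQuadratic (gram lam W (fun s => S s p.1) t)
        (scoreSum W (fun s => S s p.1) (fun s => η s p.1) t) p.2 := fun t ht =>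
    measurable_expQuadratic_swap (V := fun ω => gram lam W (fun s => S s ω) t)
      (z := fun ω => scoreSum W (fun s => S s ω) (fun s => η s ω) t)
      (fun i j => (h.measurable_gram ht i j).mono (F.le t) le_rfl)
      (fun i => (h.measurable_scoreSum ht i).mono (F.le t) le_rfl)
  refine (lintegral_lintegral_swap (hjoint (t + 1) ht).aemeasurable).trans_le ?_
  refine le_trans ?_ (lintegral_lintegral_swap (hjoint t ht.le).aemeasurable).symm.le
  exact lintegral_mono fun x => h.setLIntegral_expQuadratic_le ht hA x

/-- **Self-normalized concentration**: the method of mixtures with a Gaussian prior. -/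
theorem ofReal_one_sub_le_measure [IsProbabilityMeasure μ] (h : IsSubgaussianNoise μ F m S η)
    (hlam : ∀ i, 0 < lam i) {δ : ℝ} (hδ : 0 < δ) :
    ENNReal.ofReal (1 - δ) ≤ μ {ω | ∀ t ≤ m,
      matNorm (gram lam W (fun s => S s ω) t)⁻¹
          (scoreSum W (fun s => S s ω) (fun s => η s ω) t) ^ 2 ≤
        Real.log (gram lam W (fun s => S s ω) t).det - Real.log (diagonal lam).det +
          2 * Real.log (1 / δ)} := by
  set f : ℕ → Ω → ℝ≥0∞ := fun t ω => ∫⁻ x, expQuadratic (gram lam W (fun s => S s ω) t)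
      (scoreSum W (fun s => S s ω) (fun s => η s ω) t) x with hf
  have hfm : ∀ t ≤ m, Measurable[F t] (f t) := fun t ht => h.measurable_lintegral_expQuadratic ht
  have hfeq : ∀ t ω, f t ω = ENNReal.ofReal (Real.exp
      (matNorm (gram lam W (fun s => S s ω) t)⁻¹
          (scoreSum W (fun s => S s ω) (fun s => η s ω) t) ^ 2 / 2) /
        Real.sqrt (gram lam W (fun s => S s ω) t).det) * gaussianMass n := by
    intro t ω
    have hV := posDef_gram (W := W) (S := fun s => S s ω) hlam t
    rw [matNorm_sq hV.inv]
    exact lintegral_exp_sub_quadratic hV _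
  have hD := (PosDef.diagonal hlam).det_pos
  -- The mixture starts at the constant `gaussianMass n` / √det Λ. This threshold is that constant
  -- divided by δ, so the crossing probability is at most δ; the logarithm of the non-crossing
  -- inequality is the claim.
  set ε : ℝ≥0∞ := ENNReal.ofReal (1 / (δ * Real.sqrt (diagonal lam).det)) * gaussianMass n with hε
  have hε0 : ε ≠ 0 := mul_ne_zero
    (ENNReal.ofReal_pos.2 (by have := Real.sqrt_pos.2 hD; positivity)).ne' (gaussianMass_ne_zero n)
  have hεt : ε ≠ ⊤ := ENNReal.mul_ne_top ENNReal.ofReal_ne_top (gaussianMass_ne_top n)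
  have hf0 : ∫⁻ ω, f 0 ω ∂μ = ε * ENNReal.ofReal δ := by
    have : ∀ ω, f 0 ω = ε * ENNReal.ofReal δ := by
      intro ω
      have hs := Real.sqrt_pos.2 hD
      rw [hfeq, gram_zero, scoreSum_zero, hε, mul_right_comm, ← ENNReal.ofReal_mul (by positivity)]
      congr 2
      simp [matNorm]
      field_simp
    simp [this]
  have hville := mul_measure_exists_le_le_lintegral hfm
    (fun t ht A hA => h.setLIntegral_lintegral_expQuadratic_le ht hA) ε
  rw [hf0, ENNReal.mul_le_mul_iff_right hε0 hεt] at hville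
  have hBm : MeasurableSet {ω | ∃ t ≤ m, ε ≤ f t ω} := by
    have : {ω | ∃ t ≤ m, ε ≤ f t ω} = ⋃ t ∈ Set.Iic m, {ω | ε ≤ f t ω} := by ext ω; simp
    rw [this]
    exact MeasurableSet.biUnion (Set.to_countable _) fun t ht =>
      measurableSet_le measurable_const ((hfm t ht).mono (F.le t) le_rfl)
  have hcompl := prob_compl_eq_one_sub (μ := μ) hBm
  calc ENNReal.ofReal (1 - δ) = 1 - ENNReal.ofReal δ := by
        rw [ENNReal.ofReal_sub _ hδ.le, ENNReal.ofReal_one]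
    _ ≤ μ ({ω | ∃ t ≤ m, ε ≤ f t ω}ᶜ) := by rw [hcompl]; exact tsub_le_tsub_left hville 1
    _ ≤ _ := measure_mono ?_
  intro ω hω t ht
  have hlt : f t ω < ε := by
    by_contra hcon
    exact hω ⟨t, ht, not_lt.1 hcon⟩
  have hV := (posDef_gram (W := W) (S := fun s => S s ω) hlam t).det_pos
  rw [hfeq, hε] at hlt
  have h1 := lt_of_mul_lt_mul_right hlt (zero_le)
  have hs := Real.sqrt_pos.2 hD
  have hsV := Real.sqrt_pos.2 hV
  rw [ENNReal.ofReal_lt_ofReal_iff (by positivity)] at h1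
  have h2 := Real.log_lt_log (by positivity) h1
  rw [Real.log_div (Real.exp_pos _).ne' hsV.ne', Real.log_exp, one_div, Real.log_inv,
    Real.log_mul hδ.ne' hs.ne', Real.log_sqrt hV.le, Real.log_sqrt hD.le] at h2
  rw [one_div, Real.log_inv]
  linarith

end IsSubgaussianNoise

end Mixture

/-! ### From predictable ranges to the confidence ellipsoid -/

section Confidence

variable {n : ℕ}

theorem sum_sq_mulVec_le (M : Matrix (Fin n) (Fin n) ℝ) (u : Fin n → ℝ) :
    ∑ j, (M *ᵥ u) j ^ 2 ≤ ‖toEuclideanCLM (𝕜 := ℝ) M‖ ^ 2 * ∑ j, u j ^ 2 := by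
  have h := (toEuclideanCLM (𝕜 := ℝ) M).le_opNorm (WithLp.toLp 2 u)
  rw [toEuclideanCLM_toLp] at h
  have h2 := pow_le_pow_left₀ (norm_nonneg _) h 2
  rw [mul_pow, EuclideanSpace.norm_sq_eq, EuclideanSpace.norm_sq_eq] at h2
  simpa [Real.norm_eq_abs, sq_abs] using h2

theorem norm_toEuclideanCLM_pos [NeZero n] {M : Matrix (Fin n) (Fin n) ℝ} (hM : IsUnit M) :
    0 < ‖toEuclideanCLM (𝕜 := ℝ) M‖ := by
  rw [norm_pos_iff]
  intro h
  have h0 : M = 0 := (map_eq_zero_iff _ (toEuclideanCLM (n := Fin n) (𝕜 := ℝ)).injective).1 h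
  rw [h0] at hM
  exact not_isUnit_zero hM

theorem matNorm_smul {P : Matrix (Fin n) (Fin n) ℝ} {c : ℝ} (hc : 0 ≤ c) (a : Fin n → ℝ) :
    matNorm P (c • a) = c * matNorm P a := by
  rw [matNorm, matNorm, mulVec_smul, dotProduct_smul, smul_dotProduct, smul_eq_mul, smul_eq_mul,
    ← mul_assoc, Real.sqrt_mul (mul_self_nonneg c), Real.sqrt_mul_self hc]

variable {Ω : Type*} [mΩ : MeasurableSpace Ω] [StandardBorelSpace Ω]
  {μ : Measure Ω} [IsProbabilityMeasure μ] {F : Filtration ℕ mΩ} {m : ℕ}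
  {ptil lo hi v : ℕ → Ω → Fin n → ℝ} {Δ : ℝ}

namespace PredictableRanges

theorem width_nonneg [NeZero n] (h : PredictableRanges μ F m ptil lo hi Δ) (hm : 1 ≤ m) :
    0 ≤ Δ := by
  have h1 : 1 ∈ Finset.Icc 1 m := Finset.mem_Icc.2 ⟨le_rfl, hm⟩
  obtain ⟨ω, hω1, hω2⟩ := ((h.mem_range 1 h1).and (h.width_le 1 h1)).exists
  linarith [(hω1 0).1, (hω1 0).2, hω2 0]

/-- Fluctuations with degenerate ranges vanish almost surely. -/
theorem ae_eq_zero (h : PredictableRanges μ F m ptil lo hi 0) :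
    ∀ᵐ ω ∂μ, ∀ t ∈ Finset.Icc 1 m, ptil t ω = 0 := by
  rw [ae_all_iff]
  intro t
  by_cases ht : t ∈ Finset.Icc 1 m
  swap
  · exact ae_of_all _ fun ω h => absurd h ht
  have h1 : ∀ i, ∀ᵐ ω ∂μ, ptil t ω i = 0 := by
    intro i
    -- A degenerate range makes the fluctuation predictable, so it equals its own conditional mean,
    -- which is 0.
    have h2 : (fun ω => ptil t ω i) =ᵐ[μ] fun ω => lo t ω i := by
      filter_upwards [h.mem_range t ht, h.width_le t ht] with ω h3 h4
      linarith [(h3 i).1, (h3 i).2, h4 i]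
    have h3 := (condExp_congr_ae (m := F (t - 1)) h2).symm.trans (h.centered t ht i)
    rw [condExp_of_stronglyMeasurable (F.le _) (h.lo_predictable t ht i).stronglyMeasurable
      ((h.integrable t ht i).congr h2)] at h3
    exact h2.trans h3
  filter_upwards [ae_all_iff.2 h1] with ω hω _
  exact funext hω

/-- The voltage fluctuations caused by noise with predictable ranges, measured in units of
`Δ ‖M‖ / 2`, are conditionally sub-Gaussian at the selected nodes. -/
theorem isSubgaussianNoise (h : PredictableRanges μ F m ptil lo hi Δ)
    {S : ℕ → Ω → Finset (Fin n)} (hS : Nonanticipating F m v S) {M : Matrix (Fin n) (Fin n) ℝ}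
    (hM : M.PosDef) {v₀ : Fin n → ℝ} (hv : ∀ t ω i, v t ω i = v₀ i + (M *ᵥ ptil t ω) i) {σ : ℝ}
    (hσ : σ = 1 / 2 * Δ * ‖toEuclideanCLM (𝕜 := ℝ) M‖) (hσ0 : 0 < σ) :
    IsSubgaussianNoise μ F m S fun t ω => σ⁻¹ • (M *ᵥ ptil t ω) where
  selection t ht A := hS.selection (t + 1) (Finset.mem_Icc.2 ⟨Nat.le_add_left 1 t, ht⟩) A
  noise t ht A i hi := by
    have hmem : t + 1 ∈ Finset.Icc 1 m := Finset.mem_Icc.2 ⟨Nat.le_add_left 1 t, ht⟩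
    have hE : MeasurableSet[F (t + 1)] {ω | S (t + 1) ω = A} :=
      F.mono (Nat.le_succ t) _ (hS.selection (t + 1) hmem A)
    -- Only observed voltages are known after the round; on the event that `A` is selected, the
    -- noise at i ∈ A is an observed voltage minus a constant.
    have h1 := ((((hS.observation (t + 1) hmem i).sub_const (v₀ i)).const_mul σ⁻¹).indicator hE)
    convert h1 using 1
    ext ω
    by_cases hω : ω ∈ {ω | S (t + 1) ω = A}
    · have hω' : S (t + 1) ω = A := hω
      rw [Set.indicator_of_mem hω, Set.indicator_of_mem hω, hω', if_pos hi, hv]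
      simp
    · rw [Set.indicator_of_notMem hω, Set.indicator_of_notMem hω]
  measurable t ht i := by
    have hmem : t + 1 ∈ Finset.Icc 1 m := Finset.mem_Icc.2 ⟨Nat.le_add_left 1 t, ht⟩
    have hp := h.measurable (t + 1) hmem
    simp only [Pi.smul_apply, mulVec, dotProduct, smul_eq_mul]
    fun_prop
  subgaussian t ht A x g hg := by
    have hmem : t + 1 ∈ Finset.Icc 1 m := Finset.mem_Icc.2 ⟨Nat.le_add_left 1 t, ht⟩
    -- Extending x by zero and moving the symmetric M onto it turns a combination of correlated
    -- voltages into one of independent injections.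
    set u : Fin n → ℝ := fun i => if i ∈ A then x i else 0 with hu
    have hsum : ∀ ω, ∑ i ∈ A, x i * (σ⁻¹ • (M *ᵥ ptil (t + 1) ω)) i =
        ∑ i, (σ⁻¹ * (M *ᵥ u) i) * ptil (t + 1) ω i := by
      intro ω
      have e1 : u ⬝ᵥ (M *ᵥ ptil (t + 1) ω) = ∑ i ∈ A, x i * (M *ᵥ ptil (t + 1) ω) i := by
        simp [dotProduct, hu, ite_mul]
      have e2 : ptil (t + 1) ω ⬝ᵥ (M *ᵥ u) = ∑ i, (M *ᵥ u) i * ptil (t + 1) ω i := by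
        rw [dotProduct_comm]; rfl
      calc ∑ i ∈ A, x i * (σ⁻¹ • (M *ᵥ ptil (t + 1) ω)) i
          = σ⁻¹ * ∑ i ∈ A, x i * (M *ᵥ ptil (t + 1) ω) i := by
            rw [Finset.mul_sum]
            exact Finset.sum_congr rfl fun i _ => by rw [Pi.smul_apply, smul_eq_mul]; ring
        _ = _ := by
            rw [← e1, dotProduct_mulVec_comm hM, e2, Finset.mul_sum]
            exact Finset.sum_congr rfl fun i _ => by ring
    have hus : ∑ i, u i ^ 2 = ∑ i ∈ A, x i ^ 2 := by simp [hu, ite_pow]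
    simp only [hsum]
    refine (lintegral_mul_exp_le (hm := F.le t) (h.measurable (t + 1) hmem)
      (h.integrable (t + 1) hmem) (h.centered (t + 1) hmem) (h.indep (t + 1) hmem)
      (h.lo_predictable (t + 1) hmem) (h.hi_predictable (t + 1) hmem) (h.mem_range (t + 1) hmem)
      (h.width_le (t + 1) hmem) _ hg).trans ?_
    gcongr
    have h1 := sum_sq_mulVec_le M u
    rw [hus] at h1
    simp only [mul_pow, ← Finset.mul_sum]
    have h2 : Δ ^ 2 / 8 * (σ⁻¹ ^ 2 * (‖toEuclideanCLM (𝕜 := ℝ) M‖ ^ 2 * ∑ i ∈ A, x i ^ 2)) =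
        (∑ i ∈ A, x i ^ 2) / 2 := by
      have h3 : Δ ^ 2 * ‖toEuclideanCLM (𝕜 := ℝ) M‖ ^ 2 = 4 * σ ^ 2 := by rw [hσ]; ring
      calc _ = (Δ ^ 2 * ‖toEuclideanCLM (𝕜 := ℝ) M‖ ^ 2) * (σ⁻¹ ^ 2 * ∑ i ∈ A, x i ^ 2) / 8 := by
            ring
        _ = (∑ i ∈ A, x i ^ 2) / 2 := by
            rw [h3]
            field_simp
            ring
    rw [← h2]
    gcongr

/-- The confidence ellipsoid for the spectral-regularized least-squares estimate. -/
theorem ofReal_one_sub_le_measure [NeZero n] (h : PredictableRanges μ F m ptil lo hi Δ)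
    (hm : 1 ≤ m) {S : ℕ → Ω → Finset (Fin n)} (hS : Nonanticipating F m v S)
    {M : Matrix (Fin n) (Fin n) ℝ} (hM : M.PosDef) {W : Matrix (Fin n) (Fin n) ℝ} {lam : Fin n → ℝ}
    (hlam : ∀ i, 0 < lam i) {ψ : Fin n → ℝ} {vnom : ℝ}
    (hv : ∀ t ω i, v t ω i = vnom + W i ⬝ᵥ ψ + (M *ᵥ ptil t ω) i) {y : ℕ → Ω → Fin n → ℝ}
    (hy : ∀ t ω i, y t ω i = v t ω i - vnom) {σ : ℝ}
    (hσ : σ = 1 / 2 * Δ * ‖toEuclideanCLM (𝕜 := ℝ) M‖) {C : ℝ}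
    (hC : matNorm (diagonal lam) ψ ≤ C) {δ : ℝ} (hδ : 0 < δ) :
    ENNReal.ofReal (1 - δ) ≤ μ {ω | ∀ t ∈ Finset.Icc 1 m, ∀ w : Fin n → ℝ,
      |w ⬝ᵥ (estimate lam W (fun s => S s ω) (fun s => y s ω) t - ψ)| ≤
        confidenceRadius lam W σ C δ (fun s => S s ω) t *
          matNorm (gram lam W (fun s => S s ω) (t - 1))⁻¹ w} := by
  have hMpos := norm_toEuclideanCLM_pos hM.isUnit
  have hσ0 : 0 ≤ σ := by
    have := h.width_nonneg hm
    rw [hσ]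
    positivity
  have key : ∀ ω t w, matNorm (gram lam W (fun s => S s ω) (t - 1))⁻¹
      (scoreSum W (fun s => S s ω) (fun s => M *ᵥ ptil s ω) (t - 1)) ≤
        σ * Real.sqrt (Real.log (gram lam W (fun s => S s ω) (t - 1)).det -
          Real.log (diagonal lam).det + 2 * Real.log (1 / δ)) →
      |w ⬝ᵥ (estimate lam W (fun s => S s ω) (fun s => y s ω) t - ψ)| ≤
        confidenceRadius lam W σ C δ (fun s => S s ω) t *
          matNorm (gram lam W (fun s => S s ω) (t - 1))⁻¹ w := by
    intro ω t w hω
    rw [confidenceRadius_eq hlam hδ]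
    refine (abs_dotProduct_estimate_sub_le (ψ := ψ) (η := fun s => M *ᵥ ptil s ω) hlam
      (fun s _ i _ => by rw [hy, hv]; ring) w).trans ?_
    exact mul_le_mul_of_nonneg_right (add_le_add hω hC) (matNorm_nonneg _ _)
  -- Noise of scale σ = 0 cannot be normalized. In that case Δ = 0, the fluctuations vanish almost
  -- surely, and only the bias remains.
  rcases hσ0.eq_or_lt with h0 | hpos
  · have hΔ : Δ = 0 := by
      rw [← h0] at hσ
      have := hMpos.ne'
      simpa [this] using hσ.symm
    subst hΔ
    have hae := h.ae_eq_zero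
    have h1 : ∀ᵐ ω ∂μ, ∀ t ∈ Finset.Icc 1 m, ∀ w : Fin n → ℝ,
        |w ⬝ᵥ (estimate lam W (fun s => S s ω) (fun s => y s ω) t - ψ)| ≤
          confidenceRadius lam W σ C δ (fun s => S s ω) t *
            matNorm (gram lam W (fun s => S s ω) (t - 1))⁻¹ w := by
      filter_upwards [hae] with ω hω t ht w
      apply key
      have h2 : scoreSum W (fun s => S s ω) (fun s => M *ᵥ ptil s ω) (t - 1) = 0 := by
        refine Finset.sum_eq_zero fun s hs => Finset.sum_eq_zero fun i _ => ?_
        have hs' : s ∈ Finset.Icc 1 m := by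
          rw [Finset.mem_Icc] at hs ht ⊢
          omega
        simp [hω s hs']
      rw [h2, ← h0]
      simp [matNorm]
    have h3 := prob_compl_eq_zero_iff₀ (μ := μ) (s := {ω | ∀ t ∈ Finset.Icc 1 m, ∀ w : Fin n → ℝ,
        |w ⬝ᵥ (estimate lam W (fun s => S s ω) (fun s => y s ω) t - ψ)| ≤
          confidenceRadius lam W σ C δ (fun s => S s ω) t *
            matNorm (gram lam W (fun s => S s ω) (t - 1))⁻¹ w})
      (NullMeasurableSet.of_compl (NullMeasurableSet.of_null h1))
    rw [h3.1 h1]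
    exact ENNReal.ofReal_le_one.2 (by linarith)
  · have hsub := h.isSubgaussianNoise hS hM (v₀ := fun i => vnom + W i ⬝ᵥ ψ) hv hσ hpos
    refine (hsub.ofReal_one_sub_le_measure (W := W) hlam hδ).trans (measure_mono ?_)
    intro ω hω t ht w
    apply key
    have h1 := hω (t - 1) (by rw [Finset.mem_Icc] at ht; omega)
    have h2 : scoreSum W (fun s => S s ω) (fun s => M *ᵥ ptil s ω) (t - 1) =
        σ • scoreSum W (fun s => S s ω) (fun s => σ⁻¹ • (M *ᵥ ptil s ω)) (t - 1) := by
      rw [← scoreSum_smul]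
      simp [smul_smul, hpos.ne']
    rw [h2, matNorm_smul hσ0]
    exact mul_le_mul_of_nonneg_left (Real.le_sqrt_of_sq_le h1) hσ0

end PredictableRanges

end Confidence

/-! ### Rewards and optimism -/

section Reward

variable {n : ℕ}

theorem maxOver_singleton (g : Fin n → ℝ) (k : Fin n) : maxOver g {k} = g k := by
  simp [maxOver]

theorem GreedySelection.one {f : Finset (Fin n) → ℝ} {S : Finset (Fin n)}
    (h : GreedySelection f 1 S) : ∃ k, S = {k} ∧ ∀ j, f {j} ≤ f {k} := by
  cases h with
  | succ i S k hS hk =>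
    cases hS
    exact ⟨k, by simp, fun j => by simpa using hk j⟩

variable {W : Matrix (Fin n) (Fin n) ℝ} {ψ : Fin n → ℝ}

theorem reward_nonneg (S : Finset (Fin n)) : 0 ≤ reward W ψ S := by
  unfold reward maxOver
  split_ifs with h
  · obtain ⟨i, hi⟩ := h
    exact (abs_nonneg _).trans (Finset.le_sup' (fun i => |W i ⬝ᵥ ψ|) hi)
  · exact le_rfl

theorem reward_le {B : ℝ} (hB : 0 ≤ B) (h : ∀ i, |W i ⬝ᵥ ψ| ≤ B) (S : Finset (Fin n)) :
    reward W ψ S ≤ B := by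
  unfold reward maxOver
  split_ifs with hS
  · exact Finset.sup'_le _ _ fun i _ => h i
  · exact hB

theorem pathRegret_le {b m : ℕ} {S : ℕ → Finset (Fin n)} {r : ℕ → ℝ}
    (h : ∀ t ∈ Finset.Icc 1 m, ∀ S' ∈ actionSet n b, reward W ψ S' - reward W ψ (S t) ≤ r t) :
    pathRegret b m W ψ S ≤ ∑ t ∈ Finset.Icc 1 m, r t :=
  Finset.sup'_le _ _ fun S' hS' => Finset.sum_le_sum fun t ht => h t ht S' hS'

theorem abs_pathRegret_le {b m : ℕ} {S : ℕ → Finset (Fin n)} {B : ℝ} (hB : 0 ≤ B)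
    (h : ∀ i, |W i ⬝ᵥ ψ| ≤ B) : |pathRegret b m W ψ S| ≤ m * B := by
  refine abs_le.2 ⟨?_, ?_⟩
  · have h1 : ∑ t ∈ Finset.Icc 1 m, (reward W ψ ∅ - reward W ψ (S t)) ≤ pathRegret b m W ψ S :=
      Finset.le_sup' (fun S' => ∑ t ∈ Finset.Icc 1 m, (reward W ψ S' - reward W ψ (S t)))
        (show ∅ ∈ actionSet n b by simp [actionSet])
    refine le_trans ?_ h1
    have h2 : ∑ t ∈ Finset.Icc 1 m, -B ≤
        ∑ t ∈ Finset.Icc 1 m, (reward W ψ ∅ - reward W ψ (S t)) :=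
      Finset.sum_le_sum fun t _ => by
        have := reward_le hB h (S t)
        have := reward_nonneg (W := W) (ψ := ψ) ∅
        linarith
    simpa using h2
  · refine (pathRegret_le (r := fun _ => B) fun t _ S' _ => ?_).trans (by simp)
    have := reward_le hB h S'
    have := reward_nonneg (W := W) (ψ := ψ) (S t)
    linarith

/-- The rows of W are unit vectors and Λ ≥ λ₁ on the diagonal. Unlike the bound 1 on the rewards,
this one keeps the cost of the failure event of order C√m. -/
theorem abs_dotProduct_le_div_sqrt [NeZero n] {lam : Fin n → ℝ} (hlam : ∀ i, 0 < lam i)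
    (hmono : Monotone lam) (hW : W * Wᵀ = 1) {C : ℝ} (hC : matNorm (diagonal lam) ψ ≤ C)
    (i : Fin n) : |W i ⬝ᵥ ψ| ≤ C / Real.sqrt (lam 0) := by
  have h0 := Real.sqrt_pos.2 (hlam 0)
  rw [le_div_iff₀ h0]
  refine le_trans (le_of_sq_le_sq ?_ (matNorm_nonneg (diagonal lam) ψ)) hC
  rw [matNorm_sq (PosDef.diagonal hlam), mul_pow, sq_abs, Real.sq_sqrt (hlam 0).le]
  have h1 := Finset.sum_mul_sq_le_sq_mul_sq Finset.univ (W i) ψ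
  rw [sum_row_sq hW, one_mul] at h1
  calc (W i ⬝ᵥ ψ) ^ 2 * lam 0 ≤ (∑ j, ψ j ^ 2) * lam 0 :=
        mul_le_mul_of_nonneg_right h1 (hlam 0).le
    _ ≤ ψ ⬝ᵥ (diagonal lam *ᵥ ψ) := by
        simp only [dotProduct, mulVec_diagonal, Finset.sum_mul]
        refine Finset.sum_le_sum fun j _ => ?_
        nlinarith [mul_le_mul_of_nonneg_right (hmono (Fin.zero_le j)) (sq_nonneg (ψ j))]

/-- The optimism principle: the instantaneous regret of an optimistic selection. -/
theorem reward_sub_reward_le {V : Matrix (Fin n) (Fin n) ℝ} {e : Fin n → ℝ} {c : ℝ} (hc : 0 ≤ c)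
    (hconf : ∀ w : Fin n → ℝ, |w ⬝ᵥ (e - ψ)| ≤ c * matNorm V⁻¹ w) {k : Fin n}
    (hk : ∀ j, optimisticReward W V e c {j} ≤ optimisticReward W V e c {k})
    {S' : Finset (Fin n)} (hS' : S' ∈ actionSet n 1) :
    reward W ψ S' - reward W ψ {k} ≤ 2 * c * matNorm V⁻¹ (W k) := by
  have hcard : S'.card ≤ 1 := by simpa [actionSet] using hS'
  have hN := mul_nonneg hc (matNorm_nonneg V⁻¹ (W k))
  rcases S'.eq_empty_or_nonempty with rfl | hne
  · have h1 := reward_nonneg (W := W) (ψ := ψ) {k}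
    have h2 : reward W ψ ∅ = 0 := by simp [reward, maxOver]
    linarith
  · obtain ⟨j, rfl⟩ := Finset.card_eq_one.1 (le_antisymm hcard hne.card_pos)
    have h1 := hk j
    simp only [optimisticReward, reward, maxOver_singleton] at h1 ⊢
    have h2 := hconf (W j)
    have h3 := hconf (W k)
    rw [dotProduct_sub] at h2 h3
    have h4 := abs_sub_abs_le_abs_sub (W j ⬝ᵥ ψ) (W j ⬝ᵥ e)
    have h5 := abs_sub_abs_le_abs_sub (W k ⬝ᵥ e) (W k ⬝ᵥ ψ)
    rw [abs_sub_comm] at h4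
    linarith

end Reward

/-! ### Summation of the regret -/

section Regret

/-- Since u²/(1 + u²) ≤ log(1 + u²), one has min(1, u)² ≤ 2 log(1 + u²); Cauchy–Schwarz over the m
rounds then gives the square root. -/
theorem sum_min_one_mul_sqrt_le {m : ℕ} {u : ℕ → ℝ} (hu : ∀ t, 0 ≤ u t) {c U : ℝ} (hc : 0 ≤ c)
    (hU : ∑ t ∈ Finset.Icc 1 m, Real.log (1 + u t ^ 2) ≤ U) :
    ∑ t ∈ Finset.Icc 1 m, min 1 (c * u t) ≤ (1 + c) * Real.sqrt (m * (2 * U)) := by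
  have h1 : ∀ t, min 1 (c * u t) ≤ (1 + c) * min 1 (u t) := by
    intro t
    rcases le_total 1 (u t) with h | h
    · rw [min_eq_left h]
      exact (min_le_left _ _).trans (by linarith)
    · rw [min_eq_right h]
      exact (min_le_right _ _).trans (by nlinarith [hu t])
  have h2 : ∀ t, min 1 (u t) ^ 2 ≤ 2 * Real.log (1 + u t ^ 2) := by
    intro t
    have h3 : 1 - (1 + u t ^ 2)⁻¹ ≤ Real.log (1 + u t ^ 2) :=
      Real.one_sub_inv_le_log_of_pos (by positivity)
    have h4 : (1 + u t ^ 2) * (1 + u t ^ 2)⁻¹ = 1 := mul_inv_cancel₀ (by positivity)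
    have h5 : 0 < (1 + u t ^ 2)⁻¹ := by positivity
    rcases le_total 1 (u t) with h | h
    · rw [min_eq_left h]
      nlinarith
    · rw [min_eq_right h]
      have h6 : u t ^ 2 ≤ 1 := pow_le_one₀ (hu t) h
      nlinarith [mul_nonneg (sq_nonneg (u t)) h5.le]
  refine (Finset.sum_le_sum fun t _ => h1 t).trans ?_
  rw [← Finset.mul_sum]
  refine mul_le_mul_of_nonneg_left (Real.le_sqrt_of_sq_le ?_) (by linarith)
  have h3 := sq_sum_le_card_mul_sum_sq (s := Finset.Icc 1 m) (f := fun t => min 1 (u t))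
  refine h3.trans ?_
  rw [Nat.card_Icc, Nat.add_sub_cancel]
  refine mul_le_mul_of_nonneg_left ?_ (Nat.cast_nonneg m)
  refine (Finset.sum_le_sum fun t _ => h2 t).trans ?_
  rw [← Finset.mul_sum]
  linarith

theorem _root_.MeasureTheory.integral_le_add_mul_of_measure_le {Ω : Type*} [MeasurableSpace Ω]
    {μ : Measure Ω} [IsProbabilityMeasure μ] {X : Ω → ℝ} (hX : Measurable X) (hint : Integrable X μ)
    {G D δ : ℝ} (hG : 0 ≤ G) (hD : 0 ≤ D) (hXD : ∀ ω, X ω ≤ D)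
    (hprob : ENNReal.ofReal (1 - δ) ≤ μ {ω | X ω ≤ G}) : ∫ ω, X ω ∂μ ≤ G + D * δ := by
  set E : Set Ω := {ω | X ω ≤ G} with hE
  have hEm : MeasurableSet E := measurableSet_le hX measurable_const
  have h1 : μ.real Eᶜ ≤ δ := by
    rw [probReal_compl_eq_one_sub hEm]
    have : 1 - δ ≤ μ.real E := by
      rw [Measure.real, ← ENNReal.ofReal_le_iff_le_toReal (measure_ne_top _ _)]
      exact hprob
    linarith
  have h2 : ∫ ω, X ω ∂μ ≤ ∫ ω, (G + Eᶜ.indicator (fun _ => D) ω) ∂μ := by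
    refine integral_mono hint ((integrable_const G).add
      ((integrable_const D).indicator hEm.compl)) fun ω => ?_
    by_cases hω : ω ∈ E
    · have : ω ∉ Eᶜ := fun h => h hω
      simp only [Set.indicator_of_notMem this, add_zero]
      exact hω
    · have : ω ∈ Eᶜ := hω
      simp only [Set.indicator_of_mem this]
      linarith [hXD ω]
  rw [integral_add (integrable_const G) ((integrable_const D).indicator hEm.compl),
    integral_indicator_const _ hEm.compl] at h2
  simp only [integral_const, probReal_univ, smul_eq_mul] at h2
  nlinarith

variable {n : ℕ} {Ω : Type*} [mΩ : MeasurableSpace Ω] {F : Filtration ℕ mΩ} {m : ℕ}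
  {v : ℕ → Ω → Fin n → ℝ} {S : ℕ → Ω → Finset (Fin n)}

theorem Nonanticipating.measurable_pathRegret (hS : Nonanticipating F m v S) (b : ℕ)
    (W : Matrix (Fin n) (Fin n) ℝ) (ψ : Fin n → ℝ) :
    Measurable fun ω => pathRegret b m W ψ fun s => S s ω := by
  have h1 : ∀ t ∈ Finset.Icc 1 m, Measurable fun ω => reward W ψ (S t ω) := by
    intro t ht
    simp only [← sum_indicator_eq (S t) (fun A _ => reward W ψ A)]
    exact Finset.measurable_fun_sum _ fun A _ =>
      measurable_const.indicator (F.le _ _ (hS.selection t ht A))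
  have h2 := Finset.measurable_sup' (actionSet_nonempty n b) (f := fun S' ω =>
    ∑ t ∈ Finset.Icc 1 m, (reward W ψ S' - reward W ψ (S t ω))) fun S' _ =>
      Finset.measurable_fun_sum _ fun t ht => (h1 t ht).const_sub _
  convert h2 using 1
  ext ω
  rw [Finset.sup'_apply]
  rfl

variable [NeZero n] {lam : Fin n → ℝ} {W : Matrix (Fin n) (Fin n) ℝ} {ψ : Fin n → ℝ}

/-- At confidence level (1 + m/λ₁)⁻¹ the radicand is at most 2dl + 2l ≤ 4dl, where l = log(1 + m/λ₁)
and d ≥ 1. The factor 2 before the square root of the exploration parameter absorbs this 4; the term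
in δ is only slack. -/
theorem confidenceRadius_le_explorationParam (hlam : ∀ i, 0 < lam i) (hmono : Monotone lam)
    (hW : W * Wᵀ = 1) {S : ℕ → Finset (Fin n)} {k : ℕ → Fin n}
    (hS : ∀ t ∈ Finset.Icc 1 m, S t = {k t}) (hm : 1 ≤ m) {t : ℕ} (ht : t ∈ Finset.Icc 1 m)
    {σ C δ : ℝ} (hσ : 0 ≤ σ) (hδ : 0 < δ) (hδ1 : δ < 1) :
    confidenceRadius lam W σ C (1 + (m : ℝ) / lam 0)⁻¹ S t ≤ explorationParam lam m σ C δ := by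
  have h0 := hlam 0
  have hl := log_one_add_div_pos hlam hm
  have hd : (1 : ℝ) ≤ effectiveDim lam m := by exact_mod_cast one_le_effectiveDim hlam hm
  have hlg : 0 < Real.log (1 / δ) := Real.log_pos (by rw [lt_div_iff₀ hδ]; linarith)
  have h1 := log_det_gram_le_effectiveDim hlam hmono hW hS hm
    (t := t - 1) ((Nat.sub_le t 1).trans (Finset.mem_Icc.1 ht).2)
  rw [confidenceRadius_eq hlam (by positivity), explorationParam, one_div, inv_inv]
  gcongr ?_ + C
  have h2 : 2 * σ * Real.sqrt (effectiveDim lam m * Real.log (1 + (m : ℝ) / lam 0) +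
      2 * Real.log (1 / δ)) = σ * Real.sqrt (2 ^ 2 * (effectiveDim lam m *
        Real.log (1 + (m : ℝ) / lam 0) + 2 * Real.log (1 / δ))) := by
    rw [Real.sqrt_mul (by norm_num), Real.sqrt_sq (by norm_num)]
    ring
  rw [h2]
  refine mul_le_mul_of_nonneg_left (Real.sqrt_le_sqrt ?_) hσ
  nlinarith

/-- The regret of a sampler run, while its confidence ellipsoids hold. -/
theorem IsSamplerRun.pathRegret_le (hlam : ∀ i, 0 < lam i) (hmono : Monotone lam)
    (hW : W * Wᵀ = 1) (hm : 1 ≤ m) (hψ : ∀ i, |W i ⬝ᵥ ψ| ≤ 1) {S : ℕ → Finset (Fin n)}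
    {y : ℕ → Fin n → ℝ} {σ C δ : ℝ} (hσ : 0 ≤ σ) (hC : 0 ≤ C) (hδ : 0 < δ) (hδ1 : δ < 1)
    (hrun : IsSamplerRun lam W (explorationParam lam m σ C δ) 1 m y S)
    (hconf : ∀ t ∈ Finset.Icc 1 m, ∀ w : Fin n → ℝ, |w ⬝ᵥ (estimate lam W S y t - ψ)| ≤
      confidenceRadius lam W σ C (1 + (m : ℝ) / lam 0)⁻¹ S t *
        matNorm (gram lam W S (t - 1))⁻¹ w) :
    pathRegret 1 m W ψ S ≤ (1 + 2 * explorationParam lam m σ C δ) *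
      Real.sqrt (m * (2 * (2 * (effectiveDim lam m * Real.log (1 + (m : ℝ) / lam 0))))) := by
  have hk : ∀ t, ∃ k, t ∈ Finset.Icc 1 m → S t = {k} ∧ ∀ j,
      optimisticReward W (gram lam W S (t - 1)) (estimate lam W S y t)
        (explorationParam lam m σ C δ) {j} ≤
      optimisticReward W (gram lam W S (t - 1)) (estimate lam W S y t)
        (explorationParam lam m σ C δ) {k} := by
    intro t
    by_cases ht : t ∈ Finset.Icc 1 m
    · obtain ⟨k, hk⟩ := (hrun t ht).one
      exact ⟨k, fun _ => hk⟩
    · exact ⟨0, fun h => absurd h ht⟩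
  choose k hk using hk
  have hS : ∀ t ∈ Finset.Icc 1 m, S t = {k t} := fun t ht => (hk t ht).1
  set c := explorationParam lam m σ C δ with hcdef
  have hc : 0 ≤ c := by
    rw [hcdef, explorationParam]
    positivity
  -- Truncation at 1 is available because the rewards lie in [0, 1]; without it the potential
  -- argument would fail for large norms.
  refine (SpectralSampling.pathRegret_le (r := fun t =>
    min 1 (2 * c * matNorm (gram lam W S (t - 1))⁻¹ (W (k t)))) fun t ht S' hS' => ?_).trans
      (sum_min_one_mul_sqrt_le (fun t => matNorm_nonneg _ _) (by positivity) ?_)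
  · refine le_min ?_ ?_
    · have h1 := reward_le zero_le_one hψ S'
      have h2 := reward_nonneg (W := W) (ψ := ψ) (S t)
      linarith
    · rw [hS t ht]
      refine reward_sub_reward_le hc (fun w => (hconf t ht w).trans ?_) (hk t ht).2 hS'
      exact mul_le_mul_of_nonneg_right
        (confidenceRadius_le_explorationParam hlam hmono hW hS hm ht hσ hδ hδ1) (matNorm_nonneg _ _)
  · rw [sum_log_one_add_matNorm_sq hlam hS]
    exact log_det_gram_le_effectiveDim hlam hmono hW hS hm le_rfl

/-- Applied with a = √m, b = √λ₁, l = log(1 + m/λ₁) and g = log(1/δ). The failure term is at most Ca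
because ab ≤ a² + b². The constant 16 is set by the product of the two square roots: 2·4·σ·rs with
rs ≤ 2P. -/
theorem regret_bound_arith {a b d l g σ C : ℝ} (ha : 0 ≤ a) (hb : 0 < b) (hd : 1 ≤ d) (hl : 0 ≤ l)
    (hg : 0 ≤ g) (hσ : 0 ≤ σ) (hC : 0 ≤ C) :
    (1 + 2 * (2 * σ * Real.sqrt (d * l + 2 * g) + C)) * Real.sqrt (a ^ 2 * (2 * (2 * (d * l)))) +
      a ^ 2 * (C / b) * (1 + a ^ 2 / b ^ 2)⁻¹ ≤ 16 * (1 + σ + C) * d * a * (1 + l + g) := by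
  have hd0 : 0 ≤ d := by linarith
  have hdl : 0 ≤ d * l := mul_nonneg hd0 hl
  have h1 : Real.sqrt (a ^ 2 * (2 * (2 * (d * l)))) = 2 * a * Real.sqrt (d * l) := by
    rw [show a ^ 2 * (2 * (2 * (d * l))) = (2 * a) ^ 2 * (d * l) by ring,
      Real.sqrt_mul (sq_nonneg _), Real.sqrt_sq (by positivity)]
  set s := Real.sqrt (d * l) with hs
  set r := Real.sqrt (d * l + 2 * g) with hr
  set P := d * (1 + l + g) with hP
  have hP0 : 1 ≤ P := by nlinarith
  have hs2 : s ^ 2 = d * l := Real.sq_sqrt hdl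
  have hr2 : r ^ 2 = d * l + 2 * g := Real.sq_sqrt (by positivity)
  have hs0 : 0 ≤ s := Real.sqrt_nonneg _
  have hr0 : 0 ≤ r := Real.sqrt_nonneg _
  have hsr : s ≤ r := Real.sqrt_le_sqrt (by linarith)
  have hdg : g ≤ d * g := by nlinarith
  have hsP : s ≤ P := by
    have : d * l ≤ P := by nlinarith [mul_nonneg hd0 hg]
    nlinarith
  have hrs : r * s ≤ 2 * P := by
    calc r * s ≤ r * r := mul_le_mul_of_nonneg_left hsr hr0
      _ = d * l + 2 * g := by rw [← sq, hr2]
      _ ≤ 2 * P := by nlinarith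
  have h2 : a ^ 2 * (C / b) * (1 + a ^ 2 / b ^ 2)⁻¹ ≤ C * a := by
    have e : a ^ 2 * (C / b) * (1 + a ^ 2 / b ^ 2)⁻¹ = C * a * (a * b / (b ^ 2 + a ^ 2)) := by
      field_simp
    rw [e]
    refine mul_le_of_le_one_right (mul_nonneg hC ha) ((div_le_one (by positivity)).2 ?_)
    nlinarith [sq_nonneg (a - b), mul_nonneg ha hb.le]
  rw [h1]
  have h3 : (1 + 2 * C) * s ≤ (1 + 2 * C) * P := mul_le_mul_of_nonneg_left hsP (by positivity)
  have h4 : σ * (r * s) ≤ σ * (2 * P) := mul_le_mul_of_nonneg_left hrs hσ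
  have h5 : C ≤ C * P := le_mul_of_one_le_right hC hP0
  have h6 : 2 * ((1 + 2 * C) * s + 4 * (σ * (r * s))) + C ≤ 16 * (1 + σ + C) * P := by
    nlinarith
  calc _ ≤ (1 + 2 * (2 * σ * r + C)) * (2 * a * s) + C * a := by gcongr
    _ = (2 * ((1 + 2 * C) * s + 4 * (σ * (r * s))) + C) * a := by ring
    _ ≤ (16 * (1 + σ + C) * P) * a := mul_le_mul_of_nonneg_right h6 ha
    _ = _ := by rw [hP]; ring

end Regret

end SpectralSampling

end

/-! ### The main theorem -/

theorem theorem2 :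
    ∃ K : ℝ, 0 < K ∧
      ∀ (n : ℕ) [NeZero n] (net : SpectralSampling.RadialNetwork n) (κ : ℝ)
        -- the Laplacian exists, the effective-resistance bound, and the graph Fourier basis
        (_ : IsUnit (net.sensitivity κ)) (_ : net.EffectiveResistanceBound κ)
        (W : Matrix (Fin n) (Fin n) ℝ) (lam : Fin n → ℝ)
        (_ : SpectralSampling.IsFourierBasis (net.laplacian κ) W lam)
        -- the probability space and the information available after each round
        (Ω : Type*) [mΩ : MeasurableSpace Ω] [StandardBorelSpace Ω]
        (μ : Measure Ω) [IsProbabilityMeasure μ] (F : Filtration ℕ mΩ) (m : ℕ) (_ : 1 ≤ m)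
        -- nominal injections, fluctuations with predictable ranges, active and reactive injections
        (vnom : ℝ) (pstar : Fin n → ℝ) (ptil lo hi p q v : ℕ → Ω → Fin n → ℝ) (Δ : ℝ)
        (_ : SpectralSampling.PredictableRanges μ F m ptil lo hi Δ)
        (_ : ∀ t ω, p t ω = pstar + ptil t ω)
        (_ : ∀ t ω, SpectralSampling.UniformRatio κ (p t ω) (q t ω))
        (_ : ∀ t ω, v t ω = net.voltage vnom (p t ω) (q t ω))
        -- the coefficients to be estimated, and the parameters of the confidence bound
        (ψ : Fin n → ℝ) (_ : ψ = (Matrix.diagonal lam)⁻¹ *ᵥ (Wᵀ *ᵥ pstar))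
        (σ : ℝ) (_ : σ = 1 / 2 * Δ * ‖Matrix.toEuclideanCLM (𝕜 := ℝ) (net.sensitivity κ)‖)
        (C : ℝ) (_ : SpectralSampling.matNorm (Matrix.diagonal lam) ψ ≤ C)
        (δ : ℝ) (_ : 0 < δ) (_ : δ < 1)
        -- the selections and the centred voltages
        (S : ℕ → Ω → Finset (Fin n)) (_ : SpectralSampling.Nonanticipating F m v S)
        (y : ℕ → Ω → Fin n → ℝ) (_ : ∀ t ω i, y t ω i = v t ω i - vnom),
        -- confidence ellipsoid
        (ENNReal.ofReal (1 - δ) ≤ μ {ω | ∀ t ∈ Finset.Icc 1 m, ∀ w : Fin n → ℝ,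
          |w ⬝ᵥ (SpectralSampling.estimate lam W (fun s => S s ω) (fun s => y s ω) t - ψ)|
            ≤ SpectralSampling.confidenceRadius lam W σ C δ (fun s => S s ω) t *
              SpectralSampling.matNorm
                (SpectralSampling.gram lam W (fun s => S s ω) (t - 1))⁻¹ w}) ∧
        (∀ t ∈ Finset.Icc 1 m, ∀ ω,
          SpectralSampling.confidenceRadius lam W σ C δ (fun s => S s ω) t
            ≤ σ * Real.sqrt (∑ i, Real.log (1 + ((t : ℝ) - 1) / lam i) + 2 * Real.log (1 / δ))
              + C) ∧
        -- regret of the sampler with one node per round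
        ((∀ ω, SpectralSampling.IsSamplerRun lam W
            (SpectralSampling.explorationParam lam m σ C δ) 1 m (fun s => y s ω)
              (fun s => S s ω)) →
          (∀ i, |W i ⬝ᵥ ψ| ≤ 1) →
          Integrable (fun ω => SpectralSampling.pathRegret 1 m W ψ (fun s => S s ω)) μ ∧
          SpectralSampling.regret μ 1 m W ψ S
            ≤ K * (1 + σ + C) * (SpectralSampling.effectiveDim lam m : ℝ) * Real.sqrt m *
              (1 + Real.log (1 + (m : ℝ) / lam 0) + Real.log (1 / δ))) := by
  refine ⟨16, by norm_num, ?_⟩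
  intro n _ net κ hunit hres W lam hW Ω _ _ μ _ F m hm vnom pstar ptil lo hi p q v Δ hpr hp hq hv
    ψ hψ σ hσ C hC δ hδ hδ1 S hS y hy
  have hM := net.posDef_sensitivity hunit hres
  have hlam := hW.eigenvalue_pos hM.inv
  have hWW := hW.mul_transpose
  have hMW : net.sensitivity κ = W * Matrix.diagonal (fun i => (lam i)⁻¹) * Wᵀ := by
    rw [← hW.inv_eq hlam, SpectralSampling.RadialNetwork.laplacian,
      Matrix.nonsing_inv_nonsing_inv _ ((Matrix.isUnit_iff_isUnit_det _).1 hunit)]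
  have hWψ : W *ᵥ ψ = net.sensitivity κ *ᵥ pstar := by
    have hd : (Matrix.diagonal lam)⁻¹ = Matrix.diagonal fun i => (lam i)⁻¹ := by
      apply Matrix.inv_eq_right_inv
      rw [Matrix.diagonal_mul_diagonal]
      simp [(hlam _).ne']
    rw [hψ, hMW, hd, Matrix.mulVec_mulVec, Matrix.mulVec_mulVec, Matrix.mul_assoc]
  have hvψ : ∀ t ω i, v t ω i = vnom + W i ⬝ᵥ ψ + (net.sensitivity κ *ᵥ ptil t ω) i := by
    intro t ω i
    have hq' : q t ω = κ • p t ω := funext fun i => hq t ω i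
    have h1 : (W *ᵥ ψ) i = W i ⬝ᵥ ψ := rfl
    rw [hv, SpectralSampling.RadialNetwork.voltage, hq', ← h1, hWψ, add_assoc, add_assoc,
      ← Pi.add_apply, ← Pi.add_apply, ← Matrix.mulVec_add, ← hp,
      SpectralSampling.RadialNetwork.sensitivity, Matrix.add_mulVec, Matrix.smul_mulVec,
      Matrix.mulVec_smul]
  have hσ0 : 0 ≤ σ := by
    have := hpr.width_nonneg hm
    rw [hσ]
    positivity
  have hC0 : 0 ≤ C := (SpectralSampling.matNorm_nonneg _ _).trans hC
  have hconf := fun (δ : ℝ) (hδ : 0 < δ) =>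
    hpr.ofReal_one_sub_le_measure hm hS hM hlam hvψ hy hσ hC hδ
  refine ⟨hconf δ hδ, fun t ht ω => SpectralSampling.confidenceRadius_le hlam hW.orthonormal hδ hσ0
    (Finset.mem_Icc.1 ht).1, fun hrun hψ1 => ?_⟩
  have h0 := hlam 0
  have hb := Real.sqrt_pos.2 h0
  have hB : 0 ≤ C / Real.sqrt (lam 0) := by positivity
  have hBψ := SpectralSampling.abs_dotProduct_le_div_sqrt hlam hW.sorted hWW hC
  have hmeas := hS.measurable_pathRegret 1 W ψ
  have hint : Integrable (fun ω => SpectralSampling.pathRegret 1 m W ψ (fun s => S s ω)) μ :=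
    Integrable.of_bound hmeas.aestronglyMeasurable (m * (C / Real.sqrt (lam 0)))
      (ae_of_all _ fun ω => SpectralSampling.abs_pathRegret_le hB hBψ)
  refine ⟨hint, ?_⟩
  have hl := SpectralSampling.log_one_add_div_pos hlam hm
  have hlg : 0 < Real.log (1 / δ) := Real.log_pos (by rw [lt_div_iff₀ hδ]; linarith)
  have hd : (1 : ℝ) ≤ SpectralSampling.effectiveDim lam m := by
    exact_mod_cast SpectralSampling.one_le_effectiveDim hlam hm
  -- The ellipsoids are taken at level (1 + m/λ₁)⁻¹, independently of δ, so that the failure event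
  -- contributes little to the expectation.
  have hgood := (hconf (1 + (m : ℝ) / lam 0)⁻¹ (by positivity)).trans
    (measure_mono fun ω hω => (hrun ω).pathRegret_le hlam hW.sorted hWW hm hψ1 hσ0 hC0 hδ hδ1 hω)
  have hexp : 0 ≤ SpectralSampling.explorationParam lam m σ C δ := by
    rw [SpectralSampling.explorationParam]
    positivity
  refine (integral_le_add_mul_of_measure_le hmeas hint (by positivity) (by positivity)
    (fun ω => (abs_le.1 (SpectralSampling.abs_pathRegret_le hB hBψ)).2) hgood).trans ?_
  have harith := SpectralSampling.regret_bound_arith (Real.sqrt_nonneg m) hb hd hl.le hlg.le hσ0 hC0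
  rw [Real.sq_sqrt (Nat.cast_nonneg m), Real.sq_sqrt h0.le] at harith
  exact harith
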